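/- Boolean functions are maps $f\colon\{0,1\}^n\to\{0,1\}$ of positive arity $n$, and a class is a set of Boolean functions. For classes $I,J$ let $IJ$ be the class of all compositions $f(g_1,\dots,g_n)$ with $f\in I$ of arity $n$ and $g_1,\dots,g_n\in J$ of a common arity. A clone is a class that contains all projections $(a_1,\dots,a_n)\mapsto a_i$ and is closed under composition with itself ($DD\subseteq D$ for the class $D$). For clones $C_1,C_2$, a class $K$ is $(C_1,C_2)$-stable if $KC_1\subseteq K$ and $C_2K\subseteq K$. Let $I_c$ be the clone of all projections. Notation. $\Omega$ is the class of all Boolean functions; $C$ in the lists below is the class of all constant functions (of all arities), and $C_0$, $C_1$ are the classes of the constant functions with value $0$, resp. $1$. Write $\mathbf 0=(0,\dots,0)$, $\mathbf 1=(1,\dots,1)$ and $\overline{\mathbf a}=\mathbf 1-\mathbf a$, and order $\{0,1\}^n$ componentwise. For a class $K$ and $a,b\in\{0,1\}$: $K_{a*}$, $K_{*b}$, $K_{ab}$ consist of the $f\in K$ with $f(\mathbf 0)=a$, with $f(\mathbf 1)=b$, with both; $K_=$, $K_{\ne}$, $K_{\le}$, $K_{\ge}$ consist of the $f\in K$ with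 $f(\mathbf 0)=f(\mathbf 1)$, $f(\mathbf 0)\ne f(\mathbf 1)$, $f(\mathbf 0)\le f(\mathbf 1)$, $f(\mathbf 0)\ge f(\mathbf 1)$; $K_{\ne,00}=K_{\ne}\cup K_{00}$ and $K_{\ne,11}=K_{\ne}\cup K_{11}$; and $\overline K=\{1-f: f\in K\}$. Further, $R$ is the class of reflexive functions ($f(\mathbf a)=f(\overline{\mathbf a})$ for all $\mathbf a$); $S$ is the class of self-dual functions ($f(\mathbf a)=1-f(\overline{\mathbf a})$ for all $\mathbf a$); $S^{-}$ and $S^{+}$ are the classes of all $f$ such that $f\le g$, resp. $f\ge g$, pointwise for some $g\in S$ of the same arity; $M$ is the class of monotone functions; $U$ is the class of all $f$ such that $\mathbf a\wedge\mathbf b\ne\mathbf 0$ whenever $f(\mathbf a)=f(\mathbf b)=1$; and $W$ is the class of all $f$ such that $\mathbf a\vee\mathbf b\ne\mathbf 1$ whenever $f(\mathbf a)=f(\mathbf b)=0$. Statement. For each of the following 18 clones $D$, the $(I_c,D)$-stable classes are exactly the classes listed. (a) $D=(M\cap U)_{01}$: $\Omega$, $\Omega_{\le}$, $\Omega_{\ge}$,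 $\Omega_{\ne,00}$, $\Omega_{=}$, $\Omega_{0*}\cup C$, $\Omega_{1*}\cup C$, $\Omega_{*0}\cup C$, $\Omega_{*1}\cup C$, $\Omega_{0*}$, $\Omega_{1*}$, $\Omega_{*0}$, $\Omega_{*1}$, $\Omega_{00}\cup C$, $\Omega_{11}\cup C$, $\Omega_{00}$, $\Omega_{11}$, $\Omega_{01}\cup C$, $\Omega_{10}\cup C$, $\Omega_{01}\cup C_0$, $\Omega_{10}\cup C_1$, $\Omega_{01}\cup C_1$, $\Omega_{10}\cup C_0$, $\Omega_{01}$, $\Omega_{10}$, $S^{-}$, $S^{-}_{0*}$, $S^{-}_{*0}$, $S^{-}_{01}\cup C_0$, $S^{-}_{10}\cup C_0$, $S^{-}_{01}$, $S^{-}_{10}$, $S^{-}_{00}$, $M$, $\overline{M}$, $M_{0*}$, $\overline{M_{0*}}$, $M_{*1}$, $\overline{M_{*1}}$, $M_{01}$, $\overline{M_{01}}$, $U$, $U_{01}\cup C_0$, $U_{01}$, $M\cap U$, $(M\cap U)_{01}$, $\overline{W}$, $\overline{W_{01}}\cup C_0$, $\overline{W_{01}}$, $\overline{M\cap W}$, $\overline{(M\cap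 W)_{01}}$, $U_{00}$, $\overline{W}_{00}$, $U\cap\overline{W}$, $R$, $R_{00}\cup C$, $R_{11}\cup C$, $R_{00}$, $R_{11}$, $C$, $C_0$, $C_1$, $\emptyset$. (b) $D=M\cap U$: $\Omega$, $\Omega_{\le}$, $\Omega_{\ge}$, $\Omega_{\ne,00}$, $\Omega_{=}$, $\Omega_{0*}\cup C$, $\Omega_{1*}\cup C$, $\Omega_{*0}\cup C$, $\Omega_{*1}\cup C$, $\Omega_{0*}$, $\Omega_{*0}$, $\Omega_{00}\cup C$, $\Omega_{11}\cup C$, $\Omega_{00}$, $\Omega_{01}\cup C$, $\Omega_{10}\cup C$, $\Omega_{01}\cup C_0$, $\Omega_{10}\cup C_0$, $S^{-}$, $S^{-}_{0*}$, $S^{-}_{*0}$, $S^{-}_{01}\cup C_0$, $S^{-}_{10}\cup C_0$, $S^{-}_{00}$, $M$, $\overline{M}$, $M_{0*}$, $\overline{M_{*1}}$, $U$, $U_{01}\cup C_0$, $M\cap U$, $\overline{W}$, $\overline{W_{01}}\cup C_0$, $\overline{M\cap W}$, $U_{00}$, $\overline{W}_{00}$, $U\cap\overline{W}$, $R$, $R_{00}\cup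 C$, $R_{11}\cup C$, $R_{00}$, $C$, $C_0$, $\emptyset$. (c) $D=U_{01}$: $\Omega$, $\Omega_{\ne,00}$, $\Omega_{=}$, $\Omega_{0*}$, $\Omega_{1*}$, $\Omega_{*0}$, $\Omega_{*1}$, $\Omega_{00}$, $\Omega_{11}$, $\Omega_{01}$, $\Omega_{10}$, $S^{-}$, $S^{-}_{0*}$, $S^{-}_{*0}$, $S^{-}_{01}$, $S^{-}_{10}$, $S^{-}_{00}$, $U$, $U_{01}$, $\overline{W}$, $\overline{W_{01}}$, $U_{00}$, $\overline{W}_{00}$, $U\cap\overline{W}$, $R$, $R_{00}$, $R_{11}$, $C$, $C_0$, $C_1$, $\emptyset$. (d) $D=U$: $\Omega$, $\Omega_{\ne,00}$, $\Omega_{=}$, $\Omega_{0*}$, $\Omega_{*0}$, $\Omega_{00}$, $S^{-}$, $S^{-}_{0*}$, $S^{-}_{*0}$, $S^{-}_{00}$, $U$, $\overline{W}$, $U_{00}$, $\overline{W}_{00}$, $U\cap\overline{W}$, $R$, $R_{00}$, $C$, $C_0$, $\emptyset$. (e) $D=(M\cap W)_{01}$: $\Omega$, $\Omega_{\le}$,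 $\Omega_{\ge}$, $\Omega_{\ne,11}$, $\Omega_{=}$, $\Omega_{0*}\cup C$, $\Omega_{1*}\cup C$, $\Omega_{*0}\cup C$, $\Omega_{*1}\cup C$, $\Omega_{0*}$, $\Omega_{1*}$, $\Omega_{*0}$, $\Omega_{*1}$, $\Omega_{00}\cup C$, $\Omega_{11}\cup C$, $\Omega_{00}$, $\Omega_{11}$, $\Omega_{01}\cup C$, $\Omega_{10}\cup C$, $\Omega_{01}\cup C_0$, $\Omega_{10}\cup C_1$, $\Omega_{01}\cup C_1$, $\Omega_{10}\cup C_0$, $\Omega_{01}$, $\Omega_{10}$, $S^{+}$, $S^{+}_{1*}$, $S^{+}_{*1}$, $S^{+}_{10}\cup C_1$, $S^{+}_{01}\cup C_1$, $S^{+}_{10}$, $S^{+}_{01}$, $S^{+}_{11}$, $M$, $\overline{M}$, $M_{0*}$, $\overline{M_{0*}}$, $M_{*1}$, $\overline{M_{*1}}$, $M_{01}$, $\overline{M_{01}}$, $\overline{U}$, $\overline{U_{01}}\cup C_1$, $\overline{U_{01}}$, $\overline{M\cap U}$, $\overline{(M\cap U)_{01}}$, $W$, $W_{01}\cup C_1$,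 $W_{01}$, $M\cap W$, $(M\cap W)_{01}$, $\overline{U}_{11}$, $W_{11}$, $W\cap\overline{U}$, $R$, $R_{00}\cup C$, $R_{11}\cup C$, $R_{00}$, $R_{11}$, $C$, $C_0$, $C_1$, $\emptyset$. (f) $D=M\cap W$: $\Omega$, $\Omega_{\le}$, $\Omega_{\ge}$, $\Omega_{\ne,11}$, $\Omega_{=}$, $\Omega_{0*}\cup C$, $\Omega_{1*}\cup C$, $\Omega_{*0}\cup C$, $\Omega_{*1}\cup C$, $\Omega_{1*}$, $\Omega_{*1}$, $\Omega_{00}\cup C$, $\Omega_{11}\cup C$, $\Omega_{11}$, $\Omega_{01}\cup C$, $\Omega_{10}\cup C$, $\Omega_{10}\cup C_1$, $\Omega_{01}\cup C_1$, $S^{+}$, $S^{+}_{1*}$, $S^{+}_{*1}$, $S^{+}_{10}\cup C_1$, $S^{+}_{01}\cup C_1$, $S^{+}_{11}$, $M$, $\overline{M}$, $\overline{M_{0*}}$, $M_{*1}$, $\overline{U}$, $\overline{U_{01}}\cup C_1$, $\overline{M\cap U}$, $W$, $W_{01}\cup C_1$, $M\cap W$, $\overline{U}_{11}$, $W_{11}$,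 $W\cap\overline{U}$, $R$, $R_{00}\cup C$, $R_{11}\cup C$, $R_{11}$, $C$, $C_1$, $\emptyset$. (g) $D=W_{01}$: $\Omega$, $\Omega_{\ne,11}$, $\Omega_{=}$, $\Omega_{0*}$, $\Omega_{1*}$, $\Omega_{*0}$, $\Omega_{*1}$, $\Omega_{00}$, $\Omega_{11}$, $\Omega_{01}$, $\Omega_{10}$, $S^{+}$, $S^{+}_{1*}$, $S^{+}_{*1}$, $S^{+}_{10}$, $S^{+}_{01}$, $S^{+}_{11}$, $\overline{U}$, $\overline{U_{01}}$, $W$, $W_{01}$, $\overline{U}_{11}$, $W_{11}$, $W\cap\overline{U}$, $R$, $R_{00}$, $R_{11}$, $C$, $C_0$, $C_1$, $\emptyset$. (h) $D=W$: $\Omega$, $\Omega_{\ne,11}$, $\Omega_{=}$, $\Omega_{1*}$, $\Omega_{*1}$, $\Omega_{11}$, $S^{+}$, $S^{+}_{1*}$, $S^{+}_{*1}$, $S^{+}_{11}$, $\overline{U}$, $W$, $\overline{U}_{11}$, $W_{11}$, $W\cap\overline{U}$, $R$, $R_{11}$, $C$, $C_1$, $\emptyset$. (i) $D=S_{01}$: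 $\Omega$, $\Omega_{=}$, $\Omega_{\ne}$, $\Omega_{0*}$, $\Omega_{1*}$, $\Omega_{*0}$, $\Omega_{*1}$, $\Omega_{00}$, $\Omega_{11}$, $\Omega_{01}$, $\Omega_{10}$, $S$, $S_{01}$, $\overline{S_{01}}$, $R$, $R_{00}$, $R_{11}$, $C$, $C_0$, $C_1$, $\emptyset$. (j) $D=S$: $\Omega$, $\Omega_{=}$, $\Omega_{\ne}$, $S$, $R$, $C$, $\emptyset$. (k) $D=M_{01}$: $\Omega$, $\Omega_{\ge}$, $\Omega_{\le}$, $\Omega_{=}$, $\Omega_{0*}\cup C$, $\Omega_{1*}\cup C$, $\Omega_{*0}\cup C$, $\Omega_{*1}\cup C$, $\Omega_{0*}$, $\Omega_{1*}$, $\Omega_{*0}$, $\Omega_{*1}$, $\Omega_{00}\cup C$, $\Omega_{11}\cup C$, $\Omega_{00}$, $\Omega_{11}$, $\Omega_{01}\cup C$, $\Omega_{10}\cup C$, $\Omega_{01}\cup C_0$, $\Omega_{10}\cup C_1$, $\Omega_{01}\cup C_1$, $\Omega_{10}\cup C_0$, $\Omega_{01}$, $\Omega_{10}$, $M$, $\overline{M}$,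 $M_{0*}$, $\overline{M_{0*}}$, $M_{*1}$, $\overline{M_{*1}}$, $M_{01}$, $\overline{M_{01}}$, $R$, $R_{00}\cup C$, $R_{11}\cup C$, $R_{00}$, $R_{11}$, $C$, $C_0$, $C_1$, $\emptyset$. (l) $D=M_{0*}$: $\Omega$, $\Omega_{\ge}$, $\Omega_{\le}$, $\Omega_{=}$, $\Omega_{0*}\cup C$, $\Omega_{1*}\cup C$, $\Omega_{*0}\cup C$, $\Omega_{*1}\cup C$, $\Omega_{0*}$, $\Omega_{*0}$, $\Omega_{00}\cup C$, $\Omega_{11}\cup C$, $\Omega_{00}$, $\Omega_{01}\cup C$, $\Omega_{10}\cup C$, $\Omega_{01}\cup C_0$, $\Omega_{10}\cup C_0$, $M$, $\overline{M}$, $M_{0*}$, $\overline{M_{*1}}$, $R$, $R_{00}\cup C$, $R_{11}\cup C$, $R_{00}$, $C$, $C_0$, $\emptyset$. (m) $D=M_{*1}$: $\Omega$, $\Omega_{\ge}$, $\Omega_{\le}$, $\Omega_{=}$, $\Omega_{0*}\cup C$, $\Omega_{1*}\cup C$, $\Omega_{*0}\cup C$, $\Omega_{*1}\cup C$, $\Omega_{1*}$,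 $\Omega_{*1}$, $\Omega_{00}\cup C$, $\Omega_{11}\cup C$, $\Omega_{11}$, $\Omega_{01}\cup C$, $\Omega_{10}\cup C$, $\Omega_{10}\cup C_1$, $\Omega_{01}\cup C_1$, $M$, $\overline{M}$, $\overline{M_{0*}}$, $M_{*1}$, $R$, $R_{00}\cup C$, $R_{11}\cup C$, $R_{11}$, $C$, $C_1$, $\emptyset$. (n) $D=M$: $\Omega$, $\Omega_{\ge}$, $\Omega_{\le}$, $\Omega_{=}$, $\Omega_{0*}\cup C$, $\Omega_{1*}\cup C$, $\Omega_{*0}\cup C$, $\Omega_{*1}\cup C$, $\Omega_{00}\cup C$, $\Omega_{11}\cup C$, $\Omega_{01}\cup C$, $\Omega_{10}\cup C$, $M$, $\overline{M}$, $R$, $R_{00}\cup C$, $R_{11}\cup C$, $C$, $\emptyset$. (o) $D=\Omega_{01}$: $\Omega$, $\Omega_{=}$, $\Omega_{0*}$, $\Omega_{1*}$, $\Omega_{*0}$, $\Omega_{*1}$, $\Omega_{00}$, $\Omega_{11}$, $\Omega_{01}$, $\Omega_{10}$, $R$, $R_{00}$, $R_{11}$, $C$, $C_0$, $C_1$, $\emptyset$.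 (p) $D=\Omega_{0*}$: $\Omega$, $\Omega_{=}$, $\Omega_{0*}$, $\Omega_{*0}$, $\Omega_{00}$, $R$, $R_{00}$, $C$, $C_0$, $\emptyset$. (q) $D=\Omega_{*1}$: $\Omega$, $\Omega_{=}$, $\Omega_{1*}$, $\Omega_{*1}$, $\Omega_{11}$, $R$, $R_{11}$, $C$, $C_1$, $\emptyset$. (r) $D=\Omega$: $\Omega$, $\Omega_{=}$, $R$, $C$, $\emptyset$. -/

import Mathlib

namespace BoolClasses

/-- A function of several arguments from `A` to `B`: a positive arity `n` and a map `Aⁿ → B`. -/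
abbrev MultiFun (A B : Type) : Type := Σ n : ℕ+, ((Fin n → A) → B)

/-- The composition `I J` of function classes: all `f(g₁, …, gₙ)` with `f ∈ I` of arity `n` and
`g₁, …, gₙ ∈ J` all of the same arity `m`. -/
def comp {A B C : Type} (I : Set (MultiFun B C)) (J : Set (MultiFun A B)) :
    Set (MultiFun A C) :=
  {h | ∃ (n m : ℕ+) (f : (Fin n → B) → C) (g : Fin n → (Fin m → A) → B),
    (⟨n, f⟩ : MultiFun B C) ∈ I ∧ (∀ i, (⟨m, g i⟩ : MultiFun A B) ∈ J) ∧
    h = ⟨m, fun a => f (fun i => g i a)⟩}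

/-- `F` is `(C₁, C₂)`-stable: `F C₁ ⊆ F` and `C₂ F ⊆ F`. -/
def IsStable {A B : Type} (C₁ : Set (MultiFun A A)) (C₂ : Set (MultiFun B B))
    (F : Set (MultiFun A B)) : Prop :=
  comp F C₁ ⊆ F ∧ comp C₂ F ⊆ F

/-- The set of all `(C₁, C₂)`-stable classes. -/
def stableClasses {A B : Type} (C₁ : Set (MultiFun A A)) (C₂ : Set (MultiFun B B)) :
    Set (Set (MultiFun A B)) :=
  {F | IsStable C₁ C₂ F}

/-- Boolean functions, with `{0, 1}` realised as `Bool` (`0 = false`, `1 = true`, `0 < 1`). -/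
abbrev BoolFun : Type := MultiFun Bool Bool

/-- The value `f(0, …, 0)`. -/
def valZero (f : BoolFun) : Bool := f.2 (fun _ => false)

/-- The value `f(1, …, 1)`. -/
def valOne (f : BoolFun) : Bool := f.2 (fun _ => true)

/-! Subclasses given by the values at the two constant tuples. -/

/-- Members with `f(0, …, 0) = a`. -/
def atZero (K : Set BoolFun) (a : Bool) : Set BoolFun := {f ∈ K | valZero f = a}

/-- Members with `f(1, …, 1) = b`. -/
def atOne (K : Set BoolFun) (b : Bool) : Set BoolFun := {f ∈ K | valOne f = b}

/-- Members with `f(0, …, 0) = a` and `f(1, …, 1) = b`. -/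
def atBoth (K : Set BoolFun) (a b : Bool) : Set BoolFun := atZero K a ∩ atOne K b

def eqPart (K : Set BoolFun) : Set BoolFun := {f ∈ K | valZero f = valOne f}

def neqPart (K : Set BoolFun) : Set BoolFun := {f ∈ K | valZero f ≠ valOne f}

def lePart (K : Set BoolFun) : Set BoolFun := {f ∈ K | valZero f ≤ valOne f}

def gePart (K : Set BoolFun) : Set BoolFun := {f ∈ K | valZero f ≥ valOne f}

/-! Negation, inner negation, dual, and the related properties of functions. -/

/-- The negation of `f`. -/
def neg (f : BoolFun) : BoolFun := ⟨f.1, fun a => !(f.2 a)⟩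

/-- The inner negation of `f`. -/
def innerNeg (f : BoolFun) : BoolFun := ⟨f.1, fun a => f.2 (fun i => !(a i))⟩

/-- The dual of `f`. -/
def dual (f : BoolFun) : BoolFun := ⟨f.1, fun a => !(f.2 (fun i => !(a i)))⟩

/-- The class of the negations of the members of `K`. -/
def negClass (K : Set BoolFun) : Set BoolFun := {h | ∃ f ∈ K, h = neg f}

/-- `f` is 1-separating of rank `k`. -/
def IsOneSeparating (k : ℕ) (f : BoolFun) : Prop :=
  ∀ a : Fin k → (Fin f.1 → Bool), (∀ j, f.2 (a j) = true) →
    Finset.univ.inf a ≠ (fun _ => false)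

/-- `f` is 0-separating of rank `k`. -/
def IsZeroSeparating (k : ℕ) (f : BoolFun) : Prop :=
  ∀ a : Fin k → (Fin f.1 → Bool), (∀ j, f.2 (a j) = false) →
    Finset.univ.sup a ≠ (fun _ => true)

/-! The classes. Suffixes: `0x`, `x1`, `01`, … prescribe the values at the constant tuples `0` and
`1` (`x`: no condition); `C`, `C0`, `C1` adjoin all constant functions, the constant 0 functions,
the constant 1 functions; `neg` is the class of negations. -/

/-- All Boolean functions. -/
def All : Set BoolFun := Set.univ

/-- The projections. -/
def Ic : Set BoolFun := {h | ∃ (n : ℕ+) (i : Fin n), h = ⟨n, fun a => a i⟩}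

/-- The constant functions. -/
def Const : Set BoolFun := {f | ∃ c : Bool, ∀ a, f.2 a = c}

def Const0 : Set BoolFun := atBoth Const false false

def Const1 : Set BoolFun := atBoth Const true true

/-- The reflexive functions. -/
def Refl : Set BoolFun := {f | f = innerNeg f}

/-- The self-dual functions. -/
def S : Set BoolFun := {f | f = dual f}

/-- The minorants of self-dual functions. -/
def Smin : Set BoolFun :=
  {f | ∃ g : (Fin f.1 → Bool) → Bool, (⟨f.1, g⟩ : BoolFun) ∈ S ∧ ∀ a, f.2 a ≤ g a}

/-- The majorants of self-dual functions. -/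
def Smaj : Set BoolFun :=
  {f | ∃ g : (Fin f.1 → Bool) → Bool, (⟨f.1, g⟩ : BoolFun) ∈ S ∧ ∀ a, g a ≤ f.2 a}

/-- The monotone functions. -/
def M : Set BoolFun := {f | ∀ a b : Fin f.1 → Bool, a ≤ b → f.2 a ≤ f.2 b}

/-- The functions that are 1-separating of rank 2. -/
def U : Set BoolFun := {f | IsOneSeparating 2 f}

/-- The functions that are 0-separating of rank 2. -/
def W : Set BoolFun := {f | IsZeroSeparating 2 f}

def AllLe : Set BoolFun := lePart All

def AllGe : Set BoolFun := gePart All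

def AllNeq00 : Set BoolFun := neqPart All ∪ atBoth All false false

def AllNeq11 : Set BoolFun := neqPart All ∪ atBoth All true true

def AllEq : Set BoolFun := eqPart All

def AllNeq : Set BoolFun := neqPart All

def All0x : Set BoolFun := atZero All false

def All0xC : Set BoolFun := All0x ∪ Const

def All1x : Set BoolFun := atZero All true

def All1xC : Set BoolFun := All1x ∪ Const

def Allx0 : Set BoolFun := atOne All false

def Allx0C : Set BoolFun := Allx0 ∪ Const

def Allx1 : Set BoolFun := atOne All true

def Allx1C : Set BoolFun := Allx1 ∪ Const

def All00 : Set BoolFun := atBoth All false false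

def All00C : Set BoolFun := All00 ∪ Const

def All11 : Set BoolFun := atBoth All true true

def All11C : Set BoolFun := All11 ∪ Const

def All01 : Set BoolFun := atBoth All false true

def All01C : Set BoolFun := All01 ∪ Const

def All01C0 : Set BoolFun := All01 ∪ Const0

def All01C1 : Set BoolFun := All01 ∪ Const1

def All10 : Set BoolFun := atBoth All true false

def All10C : Set BoolFun := All10 ∪ Const

def All10C0 : Set BoolFun := All10 ∪ Const0

def All10C1 : Set BoolFun := All10 ∪ Const1

def Mneg : Set BoolFun := negClass M

def M0x : Set BoolFun := atZero M false

def M0xneg : Set BoolFun := negClass M0x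

def Mx1 : Set BoolFun := atOne M true

def Mx1neg : Set BoolFun := negClass Mx1

def M01 : Set BoolFun := atBoth M false true

def M01neg : Set BoolFun := negClass M01

def S01 : Set BoolFun := atBoth S false true

def S01neg : Set BoolFun := negClass S01

def Smin0x : Set BoolFun := atZero Smin false

def Sminx0 : Set BoolFun := atOne Smin false

def Smin01 : Set BoolFun := atBoth Smin false true

def Smin01C0 : Set BoolFun := Smin01 ∪ Const0

def Smin10 : Set BoolFun := atBoth Smin true false

def Smin10C0 : Set BoolFun := Smin10 ∪ Const0

def Smin00 : Set BoolFun := atBoth Smin false false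

def Smaj1x : Set BoolFun := atZero Smaj true

def Smajx1 : Set BoolFun := atOne Smaj true

def Smaj01 : Set BoolFun := atBoth Smaj false true

def Smaj01C1 : Set BoolFun := Smaj01 ∪ Const1

def Smaj10 : Set BoolFun := atBoth Smaj true false

def Smaj10C1 : Set BoolFun := Smaj10 ∪ Const1

def Smaj11 : Set BoolFun := atBoth Smaj true true

def Uneg : Set BoolFun := negClass U

def U01 : Set BoolFun := atBoth U false true

def U01neg : Set BoolFun := negClass U01

def MU : Set BoolFun := M ∩ U

def MUneg : Set BoolFun := negClass MU

def MU01 : Set BoolFun := atBoth MU false true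

def MU01neg : Set BoolFun := negClass MU01

def U01C0 : Set BoolFun := U01 ∪ Const0

def U01negC1 : Set BoolFun := U01neg ∪ Const1

def U00 : Set BoolFun := atBoth U false false

def Uneg11 : Set BoolFun := atBoth Uneg true true

def Wneg : Set BoolFun := negClass W

def W01 : Set BoolFun := atBoth W false true

def W01neg : Set BoolFun := negClass W01

def MW : Set BoolFun := M ∩ W

def MWneg : Set BoolFun := negClass MW

def MW01 : Set BoolFun := atBoth MW false true

def MW01neg : Set BoolFun := negClass MW01

def W01C1 : Set BoolFun := W01 ∪ Const1

def W01negC0 : Set BoolFun := W01neg ∪ Const0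

def W11 : Set BoolFun := atBoth W true true

def Wneg00 : Set BoolFun := atBoth Wneg false false

def UWneg : Set BoolFun := U ∩ Wneg

def WUneg : Set BoolFun := W ∩ Uneg

def Refl00 : Set BoolFun := atBoth Refl false false

def Refl00C : Set BoolFun := Refl00 ∪ Const

def Refl11 : Set BoolFun := atBoth Refl true true

def Refl11C : Set BoolFun := Refl11 ∪ Const

end BoolClasses

open BoolClasses

/-! Being stable under the projections on the right means being closed under minors: arguments may
be permuted and identified, and inessential ones added. Each of the eighteen clones `D` contains the
ternary majority function, so a `D`-stable class `K` is closed under pointwise majority. By the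
Baker–Pixley argument (`mem_of_forall_vals`), a function belongs to `K` as soon as it can be matched
by members of `K` at every two points.

What members of `K` do at two points `a`, `b` depends, by minor closure, only on the set `T ⊆
{0,1}²` of columns `(aᵢ, bᵢ)`. Hence `K` is determined by the map sending `T` to the binary relation
of value pairs `(x, y)` with `Vals K T x y`. There are 16 sets `T` and 4 pairs, so `K` is a finite
code, and the classification becomes a finite computation.

Completeness of a list of codes: every value pair is realised by a ternary member
(`Vals.exists_ternary`), so the code of `K` is the union of the profiles of its ternary members.
Adding these profiles one at a time, and closing under an operation of `D` after each step, never
leaves a list that passes `joinCheck` and contains the empty code (`exists_code`).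

Stability of the listed codes: each `D` consists of all functions that preserve certain binary
relations. If every relation closed under a few operations of `D` is an intersection of such
invariant relations (`sepCheck`), then a code closed under these operations describes a class closed
under all of `D` (`isStable_toClass`).

Finally each code is matched with the named class (`LocalClass.carrier_eq`), whose definition is a
condition on two points together with `0` and `1`. Three tables, for `(M ∩ U)₀₁`, `(M ∩ W)₀₁` and
`S₀₁`, serve all eighteen clones: a larger clone has fewer stable classes, and these are selected by
further closure rules. -/

namespace BoolClasses

/-! ### Closure properties of stable classes -/

/-- `K` is closed under permuting and identifying arguments and adding inessential ones. -/
def MinorClosed (K : Set BoolFun) : Prop :=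
  ∀ (n m : ℕ+) (f : (Fin n → Bool) → Bool) (s : Fin n → Fin m),
    (⟨n, f⟩ : BoolFun) ∈ K → (⟨m, fun a => f (fun i => a (s i))⟩ : BoolFun) ∈ K

theorem IsStable.minorClosed {D K : Set BoolFun} (h : IsStable Ic D K) : MinorClosed K :=
  fun n m f s hf => h.1 ⟨n, m, f, fun i a => a (s i), hf, fun i => ⟨m, s i, rfl⟩, rfl⟩

/-- Substituting projections for the arguments of `f` is reindexing the arguments along a map `s`.
-/
theorem isStable_iff {D K : Set BoolFun} : IsStable Ic D K ↔ MinorClosed K ∧ comp D K ⊆ K := by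
  refine ⟨fun h => ⟨h.minorClosed, h.2⟩, fun h => ⟨?_, h.2⟩⟩
  rintro _ ⟨n, m, f, g, hf, hg, rfl⟩
  have hg' : ∀ j, ∃ s : Fin m, g j = fun a => a s := by
    intro j
    obtain ⟨k, i, e⟩ := hg j
    obtain ⟨rfl, e⟩ := Sigma.mk.inj_iff.1 e
    exact ⟨i, eq_of_heq e⟩
  choose s hs using hg'
  have := h.1 n m f s hf
  simpa [hs] using this

/-- The ternary function with a given table. -/
def op3 (t : Bool → Bool → Bool → Bool) : BoolFun :=
  ⟨⟨3, by decide⟩, fun a : Fin 3 → Bool => t (a 0) (a 1) (a 2)⟩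

/-- `K` is closed under the pointwise application of `t`. -/
def ClosedUnder (t : Bool → Bool → Bool → Bool) (K : Set BoolFun) : Prop :=
  ∀ (m : ℕ+) (f g h : (Fin m → Bool) → Bool), (⟨m, f⟩ : BoolFun) ∈ K → (⟨m, g⟩ : BoolFun) ∈ K →
    (⟨m, h⟩ : BoolFun) ∈ K → (⟨m, fun a => t (f a) (g a) (h a)⟩ : BoolFun) ∈ K

theorem IsStable.closedUnder {D K : Set BoolFun} (hK : IsStable Ic D K)
    {t : Bool → Bool → Bool → Bool} (ht : op3 t ∈ D) : ClosedUnder t K := by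
  intro m f g h hf hg hh
  refine hK.2 ⟨⟨3, by decide⟩, m, _, (![f, g, h] : Fin 3 → _), ht, ?_, rfl⟩
  intro i
  change Fin 3 at i
  fin_cases i
  · exact hf
  · exact hg
  · exact hh

/-! ### The binary relations attached to a class -/

/-- The index of a pair of bits. -/
def ix (p q : Bool) : ℕ := 2 * p.toNat + q.toNat

/-- All columns `(aᵢ, bᵢ)` lie in the subset of `{0, 1}²` coded by `T`. -/
def Fits (T : ℕ) {n : ℕ} (a b : Fin n → Bool) : Prop :=
  T < 16 ∧ ∀ i, T.testBit (ix (a i) (b i)) = true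

/-- Every member of the subset of `{0, 1}²` coded by `T` occurs as a column `(aᵢ, bᵢ)`. -/
def Covers (T : ℕ) {n : ℕ} (a b : Fin n → Bool) : Prop :=
  ∀ p q, T.testBit (ix p q) = true → ∃ i, a i = p ∧ b i = q

/-- Some member of `K` takes the values `x`, `y` at two points whose columns are in `T`. -/
def Vals (K : Set BoolFun) (T : ℕ) (x y : Bool) : Prop :=
  ∃ f ∈ K, ∃ a b, Fits T a b ∧ f.2 a = x ∧ f.2 b = y

theorem exists_testBit : ∀ d₀ d₁ d₂ d₃ : Bool, ∃ T < 16, Nat.testBit T 0 = d₀ ∧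
    Nat.testBit T 1 = d₁ ∧ Nat.testBit T 2 = d₂ ∧ Nat.testBit T 3 = d₃ := by
  decide

theorem exists_fits_covers {n : ℕ} (a b : Fin n → Bool) : ∃ T, Fits T a b ∧ Covers T a b := by
  classical
  obtain ⟨T, hT, h₀, h₁, h₂, h₃⟩ := exists_testBit (decide (∃ i, a i = false ∧ b i = false))
    (decide (∃ i, a i = false ∧ b i = true)) (decide (∃ i, a i = true ∧ b i = false))
    (decide (∃ i, a i = true ∧ b i = true))
  have key : ∀ p q, T.testBit (ix p q) = true ↔ ∃ i, a i = p ∧ b i = q := by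
    intro p q
    cases p <;> cases q <;> simp [ix, *]
  exact ⟨T, ⟨hT, fun i => (key _ _).2 ⟨i, rfl, rfl⟩⟩, fun p q h => (key p q).1 h⟩

/-- A value pair can be moved to any two points whose columns exhaust `T`: each argument of the
witness is reindexed to a coordinate carrying the same column. -/
theorem Vals.exists_eq {K : Set BoolFun} (hK : MinorClosed K) {T : ℕ} {x y : Bool}
    (h : Vals K T x y) {m : ℕ+} {a b : Fin m → Bool} (hab : Covers T a b) :
    ∃ g : (Fin m → Bool) → Bool, (⟨m, g⟩ : BoolFun) ∈ K ∧ g a = x ∧ g b = y := by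
  obtain ⟨⟨n, f⟩, hf, a', b', ⟨-, hT⟩, rfl, rfl⟩ := h
  choose s hs using fun i => hab _ _ (hT i)
  exact ⟨_, hK n m f s hf, congrArg f (funext fun i => (hs i).1),
    congrArg f (funext fun i => (hs i).2)⟩

theorem ix_decode (p q : Bool) : decide (2 ≤ ix p q) = p ∧ decide (ix p q % 2 = 1) = q ∧
    ix p q < 4 := by
  cases p <;> cases q <;> decide

theorem ix_encode : ∀ k < 4, ix (decide (2 ≤ k)) (decide (k % 2 = 1)) = k := by decide

/-- Four coordinates suffice to display all of `T`: coordinate `k` carries the pair with index `k`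
if that pair is in `T`, and otherwise repeats the column at `i₀`, which is known to lie in `T`. -/
theorem Fits.exists_covers {T n : ℕ} {a b : Fin n → Bool} (i₀ : Fin n) (h : Fits T a b) :
    ∃ a' b' : Fin 4 → Bool, Fits T a' b' ∧ Covers T a' b' := by
  refine ⟨fun k => if T.testBit k then decide (2 ≤ k.1) else a i₀,
    fun k => if T.testBit k then decide (k.1 % 2 = 1) else b i₀, ⟨h.1, fun k => ?_⟩,
    fun p q hpq => ⟨⟨ix p q, (ix_decode p q).2.2⟩, ?_⟩⟩
  · by_cases hk : T.testBit k = true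
    · simp only [hk, if_true]
      rw [ix_encode k k.2, hk]
    · simp only [hk]
      exact h.2 i₀
  · simp only [hpq, if_true]
    exact ⟨(ix_decode p q).1, (ix_decode p q).2.1⟩

/-- The three value pairs may come from different arities and points. All are first moved to one
common pair of 4-tuples covering `T`, where `t` can be applied pointwise. -/
theorem ClosedUnder.vals {K : Set BoolFun} {t : Bool → Bool → Bool → Bool} (ht : ClosedUnder t K)
    (hK : MinorClosed K) {T : ℕ} {x y x' y' x'' y'' : Bool} (h : Vals K T x y)
    (h' : Vals K T x' y') (h'' : Vals K T x'' y'') : Vals K T (t x x' x'') (t y y' y'') := by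
  have h0 := h
  obtain ⟨f, -, a, b, hab, -, -⟩ := h0
  obtain ⟨A, B, hAB, hc⟩ := hab.exists_covers ⟨0, f.1.pos⟩
  obtain ⟨g, hg, rfl, rfl⟩ := h.exists_eq hK (m := ⟨4, by decide⟩) hc
  obtain ⟨g', hg', rfl, rfl⟩ := h'.exists_eq hK (m := ⟨4, by decide⟩) hc
  obtain ⟨g'', hg'', rfl, rfl⟩ := h''.exists_eq hK (m := ⟨4, by decide⟩) hc
  exact ⟨_, ht _ g g' g'' hg hg' hg'', A, B, hAB, rfl, rfl⟩

/-- The majority function. -/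
def maj (x y z : Bool) : Bool := (x && y) || (x && z) || (y && z)

/-- Baker–Pixley interpolation. -/
theorem mem_of_forall_vals {K : Set BoolFun} (hK : MinorClosed K) (hm : ClosedUnder maj K)
    {f : BoolFun} (hf : ∀ T a b, Fits T a b → Vals K T (f.2 a) (f.2 b)) : f ∈ K := by
  classical
  obtain ⟨n, f⟩ := f
  have two : ∀ a b, ∃ g : (Fin n → Bool) → Bool, (⟨n, g⟩ : BoolFun) ∈ K ∧ g a = f a ∧ g b = f b := by
    intro a b
    obtain ⟨T, hT, hc⟩ := exists_fits_covers a b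
    exact (hf T a b hT).exists_eq hK hc
  have main : ∀ (k : ℕ) (A : Finset (Fin n → Bool)), A.card = k →
      ∃ g : (Fin n → Bool) → Bool, (⟨n, g⟩ : BoolFun) ∈ K ∧ ∀ a ∈ A, g a = f a := by
    intro k
    induction k with
    | zero =>
      intro A hA
      obtain ⟨g, hg, -⟩ := two (fun _ => false) (fun _ => false)
      exact ⟨g, hg, by simp [Finset.card_eq_zero.1 hA]⟩
    | succ k ih =>
      intro A hA
      -- Up to two points are handled directly by `two`; from three points on, majority reduces to
      -- smaller sets.
      by_cases hk : 2 < A.card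
      · obtain ⟨a, b, c, ha, hb, hc, hab, hac, hbc⟩ := Finset.two_lt_card_iff.1 hk
        have er : ∀ d ∈ A, ∃ g : (Fin n → Bool) → Bool, (⟨n, g⟩ : BoolFun) ∈ K ∧
            ∀ a ∈ A, a ≠ d → g a = f a := by
          intro d hd
          obtain ⟨g, hg, h⟩ := ih (A.erase d) (by rw [Finset.card_erase_of_mem hd, hA]; rfl)
          exact ⟨g, hg, fun a ha hne => h a (Finset.mem_erase.2 ⟨hne, ha⟩)⟩
        obtain ⟨g₁, h₁, e₁⟩ := er a ha
        obtain ⟨g₂, h₂, e₂⟩ := er b hb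
        obtain ⟨g₃, h₃, e₃⟩ := er c hc
        -- Each interpolant may be wrong only at the point omitted for it, so at every point of `A`
        -- at least two of the three are right.
        refine ⟨_, hm n g₁ g₂ g₃ h₁ h₂ h₃, fun d hd => ?_⟩
        by_cases hda : d = a
        · subst hda
          rw [e₂ d hd hab, e₃ d hd hac]
          cases g₁ d <;> cases f d <;> rfl
        · by_cases hdb : d = b
          · subst hdb
            rw [e₁ d hd hda, e₃ d hd hbc]
            cases g₂ d <;> cases f d <;> rfl
          · rw [e₁ d hd hda, e₂ d hd hdb]
            cases g₃ d <;> cases f d <;> rfl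
      · have : ∃ a b, A ⊆ {a, b} := by
          have : A.card = 1 ∨ A.card = 2 := by omega
          rcases this with h | h
          · obtain ⟨a, rfl⟩ := Finset.card_eq_one.1 h
            exact ⟨a, a, by simp⟩
          · obtain ⟨a, b, -, rfl⟩ := Finset.card_eq_two.1 h
            exact ⟨a, b, by simp⟩
        obtain ⟨a, b, hs⟩ := this
        obtain ⟨g, hg, h₁, h₂⟩ := two a b
        refine ⟨g, hg, fun c hc => ?_⟩
        rcases Finset.mem_insert.1 (hs hc) with rfl | h
        · exact h₁
        · rw [Finset.mem_singleton.1 h, h₂]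
  obtain ⟨g, hg, h⟩ := main _ Finset.univ rfl
  have : g = f := funext fun a => h a (Finset.mem_univ a)
  exact this ▸ hg

/-! ### Ternary functions suffice -/

/-- When at most three kinds of columns occur, identifying the arguments that have equal columns
leaves a function of three arguments. -/
theorem exists_ternary_of_missing {K : Set BoolFun} (hK : MinorClosed K) {f : BoolFun}
    (hf : f ∈ K) {T : ℕ} {a b : Fin f.1 → Bool} (h : Fits T a b) (e : Fin 3 → Bool × Bool)
    (he : ∀ i, ∃ k, e k = (a i, b i)) :
    ∃ g : (Fin 3 → Bool) → Bool, (⟨⟨3, by decide⟩, g⟩ : BoolFun) ∈ K ∧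
      ∃ a' b', Fits T a' b' ∧ g a' = f.2 a ∧ g b' = f.2 b := by
  classical
  obtain ⟨n, f⟩ := f
  choose s hs using he
  let i₀ : Fin n := ⟨0, n.pos⟩
  -- A listed pair that does not occur as a column might lie outside `T`; it is replaced by the
  -- column at `i₀`.
  have hr : ∀ k, ∃ c : Bool × Bool, (∃ i, c = (a i, b i)) ∧ ((∃ i, e k = (a i, b i)) → c = e k) := by
    intro k
    by_cases hk : ∃ i, e k = (a i, b i)
    · exact ⟨e k, hk, fun _ => rfl⟩
    · exact ⟨_, ⟨i₀, rfl⟩, fun h => absurd h hk⟩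
  choose c hc hce using hr
  refine ⟨_, hK n ⟨3, by decide⟩ f s hf, fun k => (c k).1, fun k => (c k).2, ⟨h.1, fun k => ?_⟩, ?_, ?_⟩
  · obtain ⟨i, hi⟩ := hc k
    simp only [hi]
    exact h.2 i
  · refine congrArg f (funext fun i => ?_)
    change (c (s i)).1 = a i
    rw [hce _ ⟨i, hs i⟩, hs i]
  · refine congrArg f (funext fun i => ?_)
    change (c (s i)).2 = b i
    rw [hce _ ⟨i, hs i⟩, hs i]

theorem exists_enum_compl : ∀ d : Bool × Bool, ∃ e : Fin 3 → Bool × Bool,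
    ∀ c, c ≠ d → ∃ k, e k = c := by
  rintro ⟨_ | _, _ | _⟩
  · exact ⟨![(false, true), (true, false), (true, true)], by decide⟩
  · exact ⟨![(false, false), (true, false), (true, true)], by decide⟩
  · exact ⟨![(false, true), (false, false), (true, true)], by decide⟩
  · exact ⟨![(false, true), (true, false), (false, false)], by decide⟩

/-- Four kinds of columns force `T` to be all of `{0,1}²`. The points may then be replaced freely,
and two points with the same values and fewer kinds of columns can be found among `a`, `b` and `0`.
-/
theorem Vals.exists_ternary {K : Set BoolFun} (hK : MinorClosed K) {T : ℕ} {x y : Bool}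
    (h : Vals K T x y) : ∃ g : (Fin 3 → Bool) → Bool, (⟨⟨3, by decide⟩, g⟩ : BoolFun) ∈ K ∧
      ∃ a b, Fits T a b ∧ g a = x ∧ g b = y := by
  obtain ⟨f, hf, a, b, hab, rfl, rfl⟩ := h
  have red : ∀ (a b : Fin f.1 → Bool) (d : Bool × Bool), Fits T a b → (∀ i, (a i, b i) ≠ d) →
      ∃ g : (Fin 3 → Bool) → Bool, (⟨⟨3, by decide⟩, g⟩ : BoolFun) ∈ K ∧
        ∃ a' b', Fits T a' b' ∧ g a' = f.2 a ∧ g b' = f.2 b := by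
    intro a b d hab hd
    obtain ⟨e, he⟩ := exists_enum_compl d
    exact exists_ternary_of_missing hK hf hab e fun i => he _ (hd i)
  by_cases hm : ∃ d, ∀ i, (a i, b i) ≠ d
  · obtain ⟨d, hd⟩ := hm
    exact red a b d hab hd
  · push Not at hm
    have full : ∀ a' b' : Fin f.1 → Bool, Fits T a' b' := by
      refine fun a' b' => ⟨hab.1, fun i => ?_⟩
      obtain ⟨j, hj⟩ := hm (a' i, b' i)
      obtain ⟨h1, h2⟩ := Prod.mk.inj hj
      rw [← h1, ← h2]
      exact hab.2 j
    by_cases hxy : f.2 a = f.2 b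
    · obtain ⟨g, hg, a', b', h1, h2, h3⟩ := red a a (false, true) (full _ _)
        (by intro i; cases a i <;> simp)
      exact ⟨g, hg, a', b', h1, h2, h3.trans hxy⟩
    -- As `f(a) ≠ f(b)`, the value `f(0)` equals one of them, so `0` can stand in for `a` or for
    -- `b`. The column `(1, 1)` then does not occur.
    · by_cases h0 : f.2 (fun _ => false) = f.2 a
      · obtain ⟨g, hg, a', b', h1, h2, h3⟩ := red (fun _ => false) b (true, true) (full _ _)
          (by intro i; simp)
        exact ⟨g, hg, a', b', h1, h2.trans h0, h3⟩
      · obtain ⟨g, hg, a', b', h1, h2, h3⟩ := red a (fun _ => false) (true, true) (full _ _)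
          (by intro i; simp)
        refine ⟨g, hg, a', b', h1, h2, h3.trans ?_⟩
        revert hxy h0
        cases f.2 a <;> cases f.2 b <;> cases f.2 (fun _ => false) <;> simp

/-! ### Codes of stable classes -/

/-- Bit `T` of `pxy` records whether members of the class take the values `x`, `y` at two points
whose columns are in `T`. -/
structure Code where
  p00 : ℕ
  p01 : ℕ
  p10 : ℕ
  p11 : ℕ

namespace Code

def plane (c : Code) : Bool → Bool → ℕ
  | false, false => c.p00
  | false, true => c.p01
  | true, false => c.p10
  | true, true => c.p11

def mem (c : Code) (T : ℕ) (x y : Bool) : Bool := (c.plane x y).testBit T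

def beq (c d : Code) : Bool :=
  Nat.beq c.p00 d.p00 && Nat.beq c.p01 d.p01 && Nat.beq c.p10 d.p10 && Nat.beq c.p11 d.p11

def or (c d : Code) : Code := ⟨c.p00 ||| d.p00, c.p01 ||| d.p01, c.p10 ||| d.p10, c.p11 ||| d.p11⟩

/-- Enlarge one plane. -/
def add (c : Code) (m : ℕ) : Bool → Bool → Code
  | false, false => ⟨c.p00 ||| m, c.p01, c.p10, c.p11⟩
  | false, true => ⟨c.p00, c.p01 ||| m, c.p10, c.p11⟩
  | true, false => ⟨c.p00, c.p01, c.p10 ||| m, c.p11⟩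
  | true, true => ⟨c.p00, c.p01, c.p10, c.p11 ||| m⟩

/-- The class described by a code. -/
def toClass (c : Code) : Set BoolFun :=
  {f | ∀ T a b, Fits T a b → c.mem T (f.2 a) (f.2 b) = true}

/-- All entries of the code are realised in `K`. -/
def Sub (c : Code) (K : Set BoolFun) : Prop := ∀ T x y, c.mem T x y = true → Vals K T x y

def Le (c d : Code) : Prop := ∀ T x y, c.mem T x y = true → d.mem T x y = true

theorem eq_of_beq {c d : Code} (h : c.beq d = true) : c = d := by
  cases c; cases d
  simpa [beq, and_assoc] using h

theorem mem_or (c d : Code) (T : ℕ) (x y : Bool) :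
    (c.or d).mem T x y = (c.mem T x y || d.mem T x y) := by
  cases x <;> cases y <;> simp [mem, plane, or]

theorem mem_add (c : Code) (m : ℕ) (p q : Bool) (T : ℕ) (x y : Bool) :
    (c.add m p q).mem T x y = (c.mem T x y || (x == p && y == q && m.testBit T)) := by
  cases x <;> cases y <;> cases p <;> cases q <;> simp [mem, plane, add]

end Code

/-- An operation `t` with three pairs to which it is applied. -/
structure Rule where
  t : Bool → Bool → Bool → Bool
  u : Bool × Bool
  v : Bool × Bool
  w : Bool × Bool

namespace Rule

/-- Bitwise conjunction applies the rule for all `T` at once: bit `T` says that the three premises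
hold at `T`. -/
def new (R : Rule) (c : Code) : ℕ :=
  c.plane R.u.1 R.u.2 &&& (c.plane R.v.1 R.v.2 &&& c.plane R.w.1 R.w.2)

def fst (R : Rule) : Bool := R.t R.u.1 R.v.1 R.w.1

def snd (R : Rule) : Bool := R.t R.u.2 R.v.2 R.w.2

def close (c : Code) (R : Rule) : Code := c.add (R.new c) R.fst R.snd

def closed (c : Code) (R : Rule) : Bool :=
  Nat.beq (R.new c ||| c.plane R.fst R.snd) (c.plane R.fst R.snd)

theorem testBit_new (R : Rule) (c : Code) (T : ℕ) :
    (R.new c).testBit T =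
      (c.mem T R.u.1 R.u.2 && (c.mem T R.v.1 R.v.2 && c.mem T R.w.1 R.w.2)) := by
  simp [new, Code.mem]

theorem vals_of_new {K : Set BoolFun} (hK : MinorClosed K) {R : Rule} (hR : ClosedUnder R.t K)
    {c : Code} (hc : c.Sub K) {T : ℕ} (h : (R.new c).testBit T = true) :
    Vals K T R.fst R.snd := by
  simp only [testBit_new, Bool.and_eq_true] at h
  exact hR.vals hK (hc _ _ _ h.1) (hc _ _ _ h.2.1) (hc _ _ _ h.2.2)

theorem sub_close {K : Set BoolFun} (hK : MinorClosed K) {R : Rule} (hR : ClosedUnder R.t K)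
    {c : Code} (hc : c.Sub K) : (close c R).Sub K := by
  intro T x y h
  simp only [close, Code.mem_add, Bool.or_eq_true, Bool.and_eq_true, beq_iff_eq] at h
  rcases h with h | ⟨⟨rfl, rfl⟩, h⟩
  · exact hc T x y h
  · exact vals_of_new hK hR hc h

theorem le_close (c : Code) (R : Rule) : c.Le (close c R) := by
  intro T x y h
  simp [close, Code.mem_add, h]

theorem closed_iff (c : Code) (R : Rule) : closed c R = true ↔
    ∀ T, c.mem T R.u.1 R.u.2 = true → c.mem T R.v.1 R.v.2 = true →
      c.mem T R.w.1 R.w.2 = true → c.mem T R.fst R.snd = true := by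
  rw [closed, Nat.beq_eq]
  constructor
  · intro h T h1 h2 h3
    have := congrArg (fun m => Nat.testBit m T) h
    simp only [Nat.testBit_or, testBit_new, h1, h2, h3] at this
    exact this.symm
  · intro h
    refine Nat.eq_of_testBit_eq fun T => ?_
    rw [Nat.testBit_or, testBit_new]
    have := h T
    revert this
    simp only [Code.mem]
    generalize (c.plane R.u.1 R.u.2).testBit T = a
    generalize (c.plane R.v.1 R.v.2).testBit T = b
    generalize (c.plane R.w.1 R.w.2).testBit T = d
    generalize (c.plane R.fst R.snd).testBit T = e
    revert a b d e
    decide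

end Rule

theorem sub_foldl_close {K : Set BoolFun} (hK : MinorClosed K) (rules : List Rule) :
    ∀ c : Code, (∀ R ∈ rules, ClosedUnder R.t K) → c.Sub K → (rules.foldl Rule.close c).Sub K := by
  induction rules with
  | nil => exact fun c _ h => h
  | cons R rules ih =>
    intro c hr hc
    exact ih _ (fun R' h => hr R' (List.mem_cons_of_mem _ h))
      (Rule.sub_close hK (hr R List.mem_cons_self) hc)

theorem le_foldl_close (rules : List Rule) : ∀ c : Code, c.Le (rules.foldl Rule.close c) := by
  induction rules with
  | nil => exact fun c T x y h => h
  | cons R rules ih => exact fun c T x y h => ih _ T x y (Rule.le_close c R T x y h)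

/-! ### Profiles of ternary functions -/

/-- The disjunction of the `g a` for `a ∈ l`. -/
def lorAll {α : Type} (l : List α) (g : α → ℕ) : ℕ := l.foldr (fun a m => g a ||| m) 0

theorem testBit_lorAll {α : Type} (l : List α) (g : α → ℕ) (T : ℕ) :
    (lorAll l g).testBit T = true ↔ ∃ a ∈ l, (g a).testBit T = true := by
  induction l with
  | nil => simp [lorAll]
  | cons a l ih =>
    rw [show lorAll (a :: l) g = g a ||| lorAll l g from rfl, Nat.testBit_or]
    simp [ih]

/-- The set of all `T < 16` that contain a given pair. -/
def above : Bool → Bool → ℕ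
  | false, false => 0xAAAA
  | false, true => 0xCCCC
  | true, false => 0xF0F0
  | true, true => 0xFF00

/-- The set of all `T` that fit the triples with binary expansions `a` and `b`. -/
def fitMask (a b : ℕ) : ℕ :=
  above (a.testBit 0) (b.testBit 0) &&&
    (above (a.testBit 1) (b.testBit 1) &&& above (a.testBit 2) (b.testBit 2))

theorem testBit_above (p q : Bool) (T : ℕ) :
    (above p q).testBit T = true ↔ T < 16 ∧ T.testBit (ix p q) = true := by
  by_cases hT : T < 16
  · simp only [hT, true_and]
    revert T
    cases p <;> cases q <;> decide
  · simp only [hT, false_and, iff_false]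
    have : above p q < 2 ^ T :=
      lt_of_lt_of_le (by cases p <;> cases q <;> decide : above p q < 2 ^ 16)
        (Nat.pow_le_pow_right (by norm_num) (by omega))
    simp [Nat.testBit_lt_two_pow this]

/-- The triple with binary expansion `a`. -/
def vec (a : ℕ) : Fin 3 → Bool := fun i => a.testBit i

theorem testBit_fitMask (a b T : ℕ) :
    (fitMask a b).testBit T = true ↔ Fits T (vec a) (vec b) := by
  simp only [fitMask, Nat.testBit_and, Bool.and_eq_true, testBit_above, Fits, Fin.forall_fin_succ,
    IsEmpty.forall_iff, vec]
  simp
  tauto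

/-- The ternary function with truth table `k`. -/
def tern (k : ℕ) : (Fin 3 → Bool) → Bool := fun v => k.testBit (Nat.ofBits v)

theorem ofBits_vec {a : ℕ} (h : a < 8) : Nat.ofBits (vec a) = a := by
  have := Nat.ofBits_testBit a 3
  rw [Nat.mod_eq_of_lt h] at this
  exact this

theorem vec_ofBits (v : Fin 3 → Bool) : vec (Nat.ofBits v) = v :=
  funext fun i => Nat.testBit_ofBits_lt v i i.2

theorem exists_tern (f : (Fin 3 → Bool) → Bool) : ∃ k < 256, tern k = f := by
  refine ⟨Nat.ofBits fun i : Fin 8 => f (vec i), Nat.ofBits_lt_two_pow _, funext fun v => ?_⟩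
  rw [tern, Nat.testBit_ofBits_lt _ _ (Nat.ofBits_lt_two_pow v)]
  exact congrArg f (vec_ofBits v)

/-- The points at which `tern k` takes the value `x`. -/
def fibre (k : ℕ) (x : Bool) : List ℕ := (List.range 8).filter fun a => k.testBit a == x

def profPlane (l l' : List ℕ) : ℕ := lorAll l fun a => lorAll l' fun b => fitMask a b

/-- The code of the class generated by `tern k`, up to closure under operations. -/
def prof (k : ℕ) : Code :=
  ⟨profPlane (fibre k false) (fibre k false), profPlane (fibre k false) (fibre k true),
    profPlane (fibre k true) (fibre k false), profPlane (fibre k true) (fibre k true)⟩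

theorem mem_prof (k T : ℕ) (x y : Bool) : (prof k).mem T x y = true ↔
    ∃ a b, Fits T a b ∧ tern k a = x ∧ tern k b = y := by
  have : (prof k).mem T x y = (profPlane (fibre k x) (fibre k y)).testBit T := by
    cases x <;> cases y <;> rfl
  rw [this]
  simp only [profPlane, testBit_lorAll, testBit_fitMask, fibre, List.mem_filter, List.mem_range,
    beq_iff_eq]
  constructor
  · rintro ⟨a, ⟨ha, rfl⟩, b, ⟨hb, rfl⟩, h⟩
    exact ⟨_, _, h, by rw [tern, ofBits_vec ha], by rw [tern, ofBits_vec hb]⟩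
  · rintro ⟨a, b, h, rfl, rfl⟩
    refine ⟨Nat.ofBits a, ⟨Nat.ofBits_lt_two_pow a, rfl⟩, Nat.ofBits b,
      ⟨Nat.ofBits_lt_two_pow b, rfl⟩, ?_⟩
    rwa [vec_ofBits, vec_ofBits]

/-- The profiles of the ternary functions. -/
def profiles : List Code :=
  [⟨0, 0, 0, 65534⟩, ⟨43520, 60640, 63688, 65534⟩, ⟨43648, 60640, 63688, 65534⟩,
    ⟨43690, 52428, 61680, 65280⟩, ⟨43690, 52428, 61680, 65472⟩, ⟨43690, 60620, 63728, 65472⟩,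
    ⟨59904, 60640, 63688, 65534⟩, ⟨60074, 60620, 63728, 65408⟩, ⟨60074, 60620, 63728, 65472⟩,
    ⟨60096, 60576, 63624, 65534⟩, ⟨60096, 60640, 63688, 65534⟩, ⟨60138, 52428, 61680, 65280⟩,
    ⟨60138, 60620, 63728, 65280⟩, ⟨60138, 60620, 63728, 65408⟩, ⟨60138, 60620, 63728, 65472⟩,
    ⟨65280, 61680, 52428, 43690⟩, ⟨65280, 61680, 52428, 60138⟩, ⟨65280, 63728, 60620, 60138⟩,
    ⟨65408, 63728, 60620, 60074⟩, ⟨65408, 63728, 60620, 60138⟩, ⟨65472, 61680, 52428, 43690⟩,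
    ⟨65472, 63728, 60620, 43690⟩, ⟨65472, 63728, 60620, 60074⟩, ⟨65472, 63728, 60620, 60138⟩,
    ⟨65534, 0, 0, 0⟩, ⟨65534, 63624, 60576, 60096⟩, ⟨65534, 63688, 60640, 43520⟩,
    ⟨65534, 63688, 60640, 43648⟩, ⟨65534, 63688, 60640, 59904⟩, ⟨65534, 63688, 60640, 60096⟩]

/-- The 256 ternary functions have only thirty profiles, so `joinCheck` needs thirty joins per code.
In the masks, 65534 stands for all `T` except the empty set, which fits no points because arities
are positive. -/
theorem prof_mem_profiles : ((List.range 256).all fun k => profiles.any (prof k).beq) = true := by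
  decide +kernel

/-- Joining a profile to one of the codes and closing under the rules gives one of the codes. -/
def joinCheck (rules : List Rule) (codes : List Code) : Bool :=
  codes.all fun c => profiles.all fun p => codes.any (rules.foldl Rule.close (c.or p)).beq

/-- The ternary functions are run through by truth table. The current code stays in the list, has
all its entries realised in `K`, and contains the profiles of the members of `K` met so far. After
all 256 it contains every value pair of `K`, by `Vals.exists_ternary`. -/
theorem exists_code {K : Set BoolFun} (hK : MinorClosed K) {rules : List Rule}
    (hr : ∀ R ∈ rules, ClosedUnder R.t K) {codes : List Code} (h0 : ⟨0, 0, 0, 0⟩ ∈ codes)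
    (hj : joinCheck rules codes = true) :
    ∃ c ∈ codes, ∀ T x y, c.mem T x y = true ↔ Vals K T x y := by
  classical
  have main : ∀ n ≤ 256, ∃ c ∈ codes, c.Sub K ∧
      ∀ k < n, (⟨⟨3, by decide⟩, tern k⟩ : BoolFun) ∈ K → (prof k).Le c := by
    intro n
    induction n with
    | zero =>
      refine fun _ => ⟨_, h0, ?_, fun k hk => absurd hk (Nat.not_lt_zero k)⟩
      intro T x y h
      cases x <;> cases y <;> simp [Code.mem, Code.plane] at h
    | succ n ih =>
      intro hn
      obtain ⟨c, hc, hs, hl⟩ := ih (by omega)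
      by_cases hk : (⟨⟨3, by decide⟩, tern n⟩ : BoolFun) ∈ K
      · obtain ⟨p, hp, hpe⟩ := List.any_eq_true.1
          (List.all_eq_true.1 prof_mem_profiles n (List.mem_range.2 (by omega)))
        have hpe := Code.eq_of_beq hpe
        obtain ⟨d, hd, hde⟩ := List.any_eq_true.1
          (List.all_eq_true.1 (List.all_eq_true.1 hj c hc) p hp)
        have hde := Code.eq_of_beq hde
        have hps : p.Sub K := by
          intro T x y h
          rw [← hpe, mem_prof] at h
          exact ⟨_, hk, h⟩
        have hle : (c.or p).Le d := hde ▸ le_foldl_close rules _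
        refine ⟨d, hd, hde ▸ sub_foldl_close hK rules _ hr ?_, fun k hkn hkK => ?_⟩
        · intro T x y h
          rw [Code.mem_or, Bool.or_eq_true] at h
          exact h.elim (hs T x y) (hps T x y)
        · intro T x y h
          refine hle T x y ?_
          rw [Code.mem_or, Bool.or_eq_true]
          rcases Nat.lt_succ_iff_lt_or_eq.1 hkn with h' | rfl
          · exact Or.inl (hl k h' hkK T x y h)
          · exact Or.inr (hpe ▸ h)
      · refine ⟨c, hc, hs, fun k hkn hkK => ?_⟩
        rcases Nat.lt_succ_iff_lt_or_eq.1 hkn with h' | rfl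
        · exact hl k h' hkK
        · exact absurd hkK hk
  obtain ⟨c, hc, hs, hl⟩ := main 256 le_rfl
  refine ⟨c, hc, fun T x y => ⟨hs T x y, fun h => ?_⟩⟩
  obtain ⟨g, hg, a, b, hab, ha, hb⟩ := h.exists_ternary hK
  obtain ⟨k, hk, rfl⟩ := exists_tern g
  exact hl k hk hg T x y ((mem_prof k T x y).2 ⟨a, b, hab, ha, hb⟩)

/-! ### Classes given by conditions on pairs of points -/

/-- A class given by a condition on `T, f(0), f(1), f(a), f(b)` for all points `a`, `b` whose columns
are in `T`. -/
structure LocalClass where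
  carrier : Set BoolFun
  pred : ℕ → Bool → Bool → Bool → Bool → Bool
  spec : ∀ f, f ∈ carrier ↔
    ∀ T a b, Fits T a b → pred T (valZero f) (valOne f) (f.2 a) (f.2 b) = true

theorem testBit_ix (T : ℕ) (p q : Bool) : T.testBit (ix p q) = match p, q with
    | false, false => T.testBit 0
    | false, true => T.testBit 1
    | true, false => T.testBit 2
    | true, true => T.testBit 3 := by
  cases p <;> cases q <;> rfl

theorem fits_full {n : ℕ} (a b : Fin n → Bool) : Fits 15 a b :=
  ⟨by decide, fun i => by cases a i <;> cases b i <;> decide⟩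

theorem Fits.ne {T n : ℕ} {a b : Fin n → Bool} (h : Fits T a b) {p q : Bool}
    (hT : ¬T.testBit (ix p q) = true) (i : Fin n) : ¬(a i = p ∧ b i = q) := by
  rintro ⟨rfl, rfl⟩
  exact hT (h.2 i)

/-! ### Pointwise descriptions of the separating, reflexive and self-dual classes -/

theorem mem_U {f : BoolFun} : f ∈ U ↔
    ∀ a b, f.2 a = true → f.2 b = true → ∃ i, a i = true ∧ b i = true := by
  have key : ∀ a : Fin 2 → Fin f.1 → Bool, Finset.univ.inf a = fun i => a 0 i && a 1 i := by
    intro a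
    funext i
    simp [Fin.univ_succ]
  constructor
  · intro h a b ha hb
    by_contra hc
    push Not at hc
    refine h ![a, b] (by simp [Fin.forall_fin_two, ha, hb]) ?_
    rw [key]
    funext i
    have := hc i
    revert this
    simp
  · intro h a ha he
    obtain ⟨i, h0, h1⟩ := h (a 0) (a 1) (ha 0) (ha 1)
    rw [key] at he
    have := congrFun he i
    simp [h0, h1] at this

theorem mem_W {f : BoolFun} : f ∈ W ↔
    ∀ a b, f.2 a = false → f.2 b = false → ∃ i, a i = false ∧ b i = false := by
  have key : ∀ a : Fin 2 → Fin f.1 → Bool, Finset.univ.sup a = fun i => a 0 i || a 1 i := by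
    intro a
    funext i
    simp [Fin.univ_succ]
  constructor
  · intro h a b ha hb
    by_contra hc
    push Not at hc
    refine h ![a, b] (by simp [Fin.forall_fin_two, ha, hb]) ?_
    rw [key]
    funext i
    have := hc i
    revert this
    simp only [Matrix.cons_val_zero, Matrix.cons_val_one]
    cases a i <;> cases b i <;> simp
  · intro h a ha he
    obtain ⟨i, h0, h1⟩ := h (a 0) (a 1) (ha 0) (ha 1)
    rw [key] at he
    have := congrFun he i
    simp [h0, h1] at this

theorem mem_Refl {f : BoolFun} : f ∈ Refl ↔ ∀ a, f.2 a = f.2 fun i => !(a i) := by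
  obtain ⟨n, f⟩ := f
  simp only [Refl, Set.mem_ofPred_eq, innerNeg, Sigma.mk.inj_iff, true_and, heq_eq_eq]
  exact funext_iff

theorem mem_S {f : BoolFun} : f ∈ S ↔ ∀ a, f.2 a = !(f.2 fun i => !(a i)) := by
  obtain ⟨n, f⟩ := f
  simp only [S, Set.mem_ofPred_eq, dual, Sigma.mk.inj_iff, true_and, heq_eq_eq]
  exact funext_iff

/-- The only obstruction to a self-dual majorant is a complementary pair on which `f` is 1 twice. -/
theorem mem_Smin {f : BoolFun} : f ∈ Smin ↔
    ∀ a, f.2 a = true → f.2 (fun i => !(a i)) = true → False := by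
  constructor
  · rintro ⟨g, hg, hle⟩ a h1 h2
    have h := mem_S.1 hg a
    have l1 := hle a
    have l2 := hle fun i => !(a i)
    rw [h1] at l1
    rw [h2] at l2
    simp only [Bool.le_iff_imp, forall_const] at l1 l2
    simp [l1, l2] at h
  · intro h
    let i₀ : Fin f.1 := ⟨0, f.1.pos⟩
    -- The majorant keeps `f` where `f` takes both values on a complementary pair; where `f` is 0
    -- twice, the coordinate `i₀` decides which of the two points gets the value 1.
    refine ⟨fun a => f.2 a || (!(f.2 fun i => !(a i)) && a i₀), mem_S.2 fun a => ?_, fun a => ?_⟩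
    · have := h a
      revert this
      simp only [Bool.not_not]
      generalize f.2 a = x
      generalize (f.2 fun i => !(a i)) = y
      generalize a i₀ = z
      revert x y z
      decide
    · change f.2 a ≤ (f.2 a || (!(f.2 fun i => !(a i)) && a i₀))
      generalize (!(f.2 fun i => !(a i)) && a i₀) = z
      generalize f.2 a = x
      revert x z
      decide

theorem mem_Smaj {f : BoolFun} : f ∈ Smaj ↔
    ∀ a, f.2 a = false → f.2 (fun i => !(a i)) = false → False := by
  constructor
  · rintro ⟨g, hg, hle⟩ a h1 h2
    have h := mem_S.1 hg a
    have l1 := hle a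
    have l2 := hle fun i => !(a i)
    rw [h1] at l1
    rw [h2] at l2
    simp only [Bool.le_iff_imp, Bool.false_eq_true, imp_false, Bool.not_eq_true] at l1 l2
    simp [l1, l2] at h
  · intro h
    let i₀ : Fin f.1 := ⟨0, f.1.pos⟩
    -- Dually, where `f` is 1 on both complementary points, the coordinate `i₀` decides which value
    -- is lowered to 0.
    refine ⟨fun a => f.2 a && (!(f.2 fun i => !(a i)) || a i₀), mem_S.2 fun a => ?_, fun a => ?_⟩
    · have := h a
      revert this
      simp only [Bool.not_not]
      generalize f.2 a = x
      generalize (f.2 fun i => !(a i)) = y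
      generalize a i₀ = z
      revert x y z
      decide
    · change (f.2 a && (!(f.2 fun i => !(a i)) || a i₀)) ≤ f.2 a
      generalize (!(f.2 fun i => !(a i)) || a i₀) = z
      generalize f.2 a = x
      revert x z
      decide

/-- A condition on complementary points, as a condition on pairs of points. -/
theorem forall_compl_iff {n : ℕ} (P : (Fin n → Bool) → (Fin n → Bool) → Prop) [DecidableRel P] :
    (∀ a, P a fun i => !(a i)) ↔
      ∀ T a b, Fits T a b → (T.testBit 0 || T.testBit 3 || decide (P a b)) = true := by
  constructor
  · intro h T a b hT
    by_cases h0 : T.testBit 0 = true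
    · simp [h0]
    by_cases h3 : T.testBit 3 = true
    · simp [h3]
    have : b = fun i => !(a i) := by
      funext i
      have e0 := hT.ne (p := false) (q := false) h0 i
      have e3 := hT.ne (p := true) (q := true) h3 i
      revert e0 e3
      cases a i <;> cases b i <;> simp
    subst this
    simp [h a]
  · intro h a
    -- The number 6 codes `{(0,1), (1,0)}`, the columns of a complementary pair.
    have := h 6 a (fun i => !(a i)) ⟨by decide, fun i => by
      change Nat.testBit 6 (ix (a i) (!(a i))) = true
      cases a i <;> decide⟩
    rw [show Nat.testBit 6 0 = false by decide, show Nat.testBit 6 3 = false by decide] at this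
    simpa using this

/-! ### Local conditions for the classes in the lists -/

namespace LocalClass

def all : LocalClass := ⟨All, fun _ _ _ _ _ => true, fun _ => by simp [All]⟩

def empty : LocalClass := ⟨∅, fun _ _ _ _ _ => false, fun f => by
  simp only [Set.mem_empty_iff_false, false_iff]
  exact fun h => Bool.false_ne_true (h 15 _ _ (fits_full (fun _ => false) fun _ => false))⟩

def const : LocalClass := ⟨Const, fun _ _ _ x y => x == y, fun f => by
  constructor
  · rintro ⟨c, hc⟩ T a b -
    simp [hc]
  · intro h
    refine ⟨valZero f, fun a => ?_⟩
    exact eq_of_beq (h 15 a (fun _ => false) (fits_full _ _))⟩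

def mono : LocalClass := ⟨M, fun T _ _ x y => T.testBit 2 || !x || y, fun f => by
  constructor
  · intro h T a b hT
    by_cases h2 : T.testBit 2 = true
    · simp [h2]
    have := h a b fun i => by
      have := hT.ne (p := true) (q := false) h2 i
      revert this
      cases a i <;> cases b i <;> simp
    revert this
    cases f.2 a <;> cases f.2 b <;> simp
  · intro h a b hab
    -- The number 11 codes all pairs except `(1, 0)`, that is, `a ≤ b`.
    have := h 11 a b ⟨by decide, fun i => by
      have : a i ≤ b i := hab i
      revert this
      rw [testBit_ix]
      cases a i <;> cases b i <;> simp <;> decide⟩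
    rw [show Nat.testBit 11 2 = false by decide] at this
    revert this
    cases f.2 a <;> cases f.2 b <;> simp⟩

def u : LocalClass := ⟨U, fun T _ _ x y => T.testBit 3 || !(x && y), fun f => by
  rw [mem_U]
  constructor
  · intro h T a b hT
    by_cases h3 : T.testBit 3 = true
    · simp [h3]
    by_contra hc
    simp only [h3, Bool.false_or, Bool.not_eq_true', Bool.not_eq_false, Bool.and_eq_true] at hc
    obtain ⟨i, hi⟩ := h a b hc.1 hc.2
    exact hT.ne (p := true) (q := true) h3 i hi
  · intro h a b ha hb
    by_contra hc
    push Not at hc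
    -- The number 7 codes all pairs except `(1, 1)`.
    have := h 7 a b ⟨by decide, fun i => by
      have := hc i
      revert this
      rw [testBit_ix]
      cases a i <;> cases b i <;> simp <;> decide⟩
    rw [show Nat.testBit 7 3 = false by decide] at this
    simp [ha, hb] at this⟩

def w : LocalClass := ⟨W, fun T _ _ x y => T.testBit 0 || x || y, fun f => by
  rw [mem_W]
  constructor
  · intro h T a b hT
    by_cases h0 : T.testBit 0 = true
    · simp [h0]
    by_contra hc
    simp only [h0, Bool.false_or, Bool.or_eq_true, not_or, Bool.not_eq_true] at hc
    obtain ⟨i, hi⟩ := h a b hc.1 hc.2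
    exact hT.ne (p := false) (q := false) h0 i hi
  · intro h a b ha hb
    by_contra hc
    push Not at hc
    -- The number 14 codes all pairs except `(0, 0)`.
    have := h 14 a b ⟨by decide, fun i => by
      have := hc i
      revert this
      rw [testBit_ix]
      cases a i <;> cases b i <;> simp <;> decide⟩
    rw [show Nat.testBit 14 0 = false by decide] at this
    simp [ha, hb] at this⟩

def smin : LocalClass := ⟨Smin, fun T _ _ x y => T.testBit 0 || T.testBit 3 || !(x && y), fun f => by
  rw [mem_Smin]
  have := forall_compl_iff fun a b => ¬(f.2 a = true ∧ f.2 b = true)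
  simpa [← Bool.not_and] using this⟩

def smaj : LocalClass := ⟨Smaj, fun T _ _ x y => T.testBit 0 || T.testBit 3 || (x || y), fun f => by
  rw [mem_Smaj]
  have := forall_compl_iff fun a b => f.2 a = false → f.2 b = false → False
  simpa using this⟩

def selfDual : LocalClass := ⟨S, fun T _ _ x y => T.testBit 0 || T.testBit 3 || (x == !y), fun f => by
  rw [mem_S]
  have := forall_compl_iff fun a b => f.2 a = !(f.2 b)
  simpa using this⟩

def refl : LocalClass := ⟨Refl, fun T _ _ x y => T.testBit 0 || T.testBit 3 || (x == y), fun f => by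
  rw [mem_Refl]
  have := forall_compl_iff fun a b => f.2 a = f.2 b
  simpa using this⟩

theorem spec_and {n : ℕ} {P Q : ℕ → (Fin n → Bool) → (Fin n → Bool) → Bool} :
    (∀ T a b, Fits T a b → (P T a b && Q T a b) = true) ↔
      (∀ T a b, Fits T a b → P T a b = true) ∧ ∀ T a b, Fits T a b → Q T a b = true := by
  simp only [Bool.and_eq_true]
  exact ⟨fun h => ⟨fun T a b hT => (h T a b hT).1, fun T a b hT => (h T a b hT).2⟩,
    fun h T a b hT => ⟨h.1 T a b hT, h.2 T a b hT⟩⟩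

theorem spec_const (n : ℕ) (e : Bool) :
    (∀ T, ∀ a b : Fin n → Bool, Fits T a b → e = true) ↔ e = true :=
  ⟨fun h => h 15 _ _ (fits_full (fun _ => false) fun _ => false), fun h _ _ _ _ => h⟩

/-- The members with a given condition on `f(0)` and `f(1)`. -/
def ends (X : LocalClass) (K : Set BoolFun) (e : Bool → Bool → Bool)
    (h : ∀ f, f ∈ K ↔ f ∈ X.carrier ∧ e (valZero f) (valOne f) = true) : LocalClass :=
  ⟨K, fun T p q x y => X.pred T p q x y && e p q, fun f => by
    rw [h f, X.spec f, ← spec_const f.1 (e _ _)]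
    exact spec_and.symm⟩

def atZero (X : LocalClass) (a : Bool) : LocalClass :=
  X.ends (BoolClasses.atZero X.carrier a) (fun p _ => p == a) fun f => by
    simp [BoolClasses.atZero]

def atOne (X : LocalClass) (b : Bool) : LocalClass :=
  X.ends (BoolClasses.atOne X.carrier b) (fun _ q => q == b) fun f => by
    simp [BoolClasses.atOne]

def atBoth (X : LocalClass) (a b : Bool) : LocalClass :=
  X.ends (BoolClasses.atBoth X.carrier a b) (fun p q => p == a && q == b) fun f => by
    simp [BoolClasses.atBoth, BoolClasses.atZero, BoolClasses.atOne]
    tauto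

def allLe : LocalClass := all.ends AllLe (fun p q => !p || q) fun f => by
  simp only [AllLe, lePart, all, Set.mem_ofPred_eq]
  cases valZero f <;> cases valOne f <;> simp

def allGe : LocalClass := all.ends AllGe (fun p q => p || !q) fun f => by
  simp only [AllGe, gePart, all, Set.mem_ofPred_eq]
  cases valZero f <;> cases valOne f <;> simp

def allEq : LocalClass := all.ends AllEq (fun p q => p == q) fun f => by
  simp [AllEq, eqPart, all]

def allNeq : LocalClass := all.ends AllNeq (fun p q => p != q) fun f => by
  simp [AllNeq, neqPart, all]

def allNeq00 : LocalClass := all.ends AllNeq00 (fun p q => !(p && q)) fun f => by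
  simp only [AllNeq00, neqPart, all, BoolClasses.atBoth, BoolClasses.atZero, BoolClasses.atOne, All]
  simp
  cases valZero f <;> cases valOne f <;> simp

def allNeq11 : LocalClass := all.ends AllNeq11 (fun p q => p || q) fun f => by
  simp only [AllNeq11, neqPart, all, BoolClasses.atBoth, BoolClasses.atZero, BoolClasses.atOne, All]
  simp
  cases valZero f <;> cases valOne f <;> simp

def inter (X Y : LocalClass) : LocalClass :=
  ⟨X.carrier ∩ Y.carrier, fun T p q x y => X.pred T p q x y && Y.pred T p q x y, fun f => by
    rw [Set.mem_inter_iff, X.spec f, Y.spec f]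
    exact spec_and.symm⟩

theorem neg_neg (f : BoolFun) : neg (neg f) = f := by
  obtain ⟨n, f⟩ := f
  simp [neg]

theorem mem_negClass {K : Set BoolFun} {f : BoolFun} : f ∈ negClass K ↔ neg f ∈ K := by
  constructor
  · rintro ⟨g, hg, rfl⟩
    rwa [neg_neg]
  · exact fun h => ⟨_, h, (neg_neg f).symm⟩

def neg (X : LocalClass) : LocalClass :=
  ⟨negClass X.carrier, fun T p q x y => X.pred T (!p) (!q) (!x) (!y), fun f => by
    rw [mem_negClass, X.spec]
    rfl⟩

/-- The union of `X` with the constant functions with values in `s`, where `X` is described by the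
values at the constant tuples up to constant functions. -/
def union (X : LocalClass) (K : Set BoolFun) (s : Bool → Bool) (e : Bool → Bool → Bool)
    (hK : ∀ f, f ∈ K ↔ ∃ c, s c = true ∧ ∀ a, f.2 a = c)
    (he : ∀ T p q x y, X.pred T p q x y = true → e p q = true)
    (hc : ∀ c, s c = true → e c c = true → ∀ T, X.pred T c c c c = true) : LocalClass :=
  ⟨X.carrier ∪ K, fun T p q x y => if e p q then X.pred T p q x y else (s p && p == x && p == y),
    fun f => by
      rw [Set.mem_union, X.spec f, hK]
      constructor
      · rintro (h | ⟨c, hs, h⟩) T a b hT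
        · rw [if_pos (he _ _ _ _ _ (h T a b hT))]
          exact h T a b hT
        · have h0 : valZero f = c := h _
          have h1 : valOne f = c := h _
          rw [h0, h1, h a, h b]
          -- An adjoined constant that meets `e` satisfies the condition of `X` anyway, by `hc`.
          split_ifs with h'
          · exact hc c hs h' T
          · simp [hs]
      · intro h
        by_cases h' : e (valZero f) (valOne f) = true
        · left
          intro T a b hT
          simpa [h'] using h T a b hT
        · right
          have h2 : ∀ a, s (valZero f) = true ∧ valZero f = f.2 a := fun a => by
            simpa [h'] using h 15 a a (fits_full a a)
          exact ⟨valZero f, (h2 fun _ => false).1, fun a => (h2 a).2.symm⟩⟩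

def unionConst (X : LocalClass) (e : Bool → Bool → Bool)
    (he : ∀ T p q x y, X.pred T p q x y = true → e p q = true)
    (hc : ∀ c, e c c = true → ∀ T, X.pred T c c c c = true) : LocalClass :=
  X.union Const (fun _ => true) e (fun f => by simp [Const]) he fun c _ => hc c

def unionConst0 (X : LocalClass) (e : Bool → Bool → Bool)
    (he : ∀ T p q x y, X.pred T p q x y = true → e p q = true)
    (hc : e false false = true → ∀ T, X.pred T false false false false = true) : LocalClass :=
  X.union Const0 (fun c => !c) e (fun f => by
    simp only [Const0, BoolClasses.atBoth, BoolClasses.atZero, BoolClasses.atOne, Const, valZero,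
      valOne]
    constructor
    · rintro ⟨⟨⟨c, h⟩, h0⟩, -⟩
      exact ⟨c, by rw [← h fun _ => false, h0]; rfl, h⟩
    · rintro ⟨c, hc, h⟩
      have hc : c = false := by simpa using hc
      subst hc
      exact ⟨⟨⟨_, h⟩, h _⟩, ⟨_, h⟩, h _⟩) he (by
    intro c hs h
    have hs : c = false := by simpa using hs
    subst hs
    exact hc h)

def unionConst1 (X : LocalClass) (e : Bool → Bool → Bool)
    (he : ∀ T p q x y, X.pred T p q x y = true → e p q = true)
    (hc : e true true = true → ∀ T, X.pred T true true true true = true) : LocalClass :=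
  X.union Const1 (fun c => c) e (fun f => by
    simp only [Const1, BoolClasses.atBoth, BoolClasses.atZero, BoolClasses.atOne, Const, valZero,
      valOne]
    constructor
    · rintro ⟨⟨⟨c, h⟩, h0⟩, -⟩
      exact ⟨c, by rw [← h fun _ => false, h0], h⟩
    · rintro ⟨c, hc, h⟩
      subst hc
      exact ⟨⟨⟨_, h⟩, h _⟩, ⟨_, h⟩, h _⟩) he (by
    intro c hs h
    subst hs
    exact hc h)

end LocalClass

/-! ### Comparison of local conditions and codes -/

/-- The set with four given membership bits. -/
def mk4 (t₀ t₁ t₂ t₃ : Bool) : ℕ := t₀.toNat + 2 * t₁.toNat + 4 * t₂.toNat + 8 * t₃.toNat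

theorem testBit_mk4 : ∀ t₀ t₁ t₂ t₃ : Bool, mk4 t₀ t₁ t₂ t₃ < 16 ∧ (mk4 t₀ t₁ t₂ t₃).testBit 0 = t₀ ∧
    (mk4 t₀ t₁ t₂ t₃).testBit 1 = t₁ ∧ (mk4 t₀ t₁ t₂ t₃).testBit 2 = t₂ ∧
    (mk4 t₀ t₁ t₂ t₃).testBit 3 = t₃ := by decide

/-- If `f` has the values `p`, `q`, `x`, `y` at `0`, `1`, `a`, `b` and the columns of `(a, b)` are in
`T`, then the pairs of points from `0, 1, a, b` satisfy `Q`. -/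
def allPairs (Q : ℕ → Bool → Bool → Bool) (T : ℕ) (p q x y : Bool) : Bool :=
  Q 2 p q &&
  (Q T x y &&
  (Q (mk4 (T.testBit 0) (T.testBit 2) (T.testBit 1) (T.testBit 3)) y x &&
  (Q (mk4 (T.testBit 0 || T.testBit 1) (T.testBit 2 || T.testBit 3) false false) p x &&
  (Q (mk4 (T.testBit 0 || T.testBit 2) (T.testBit 1 || T.testBit 3) false false) p y &&
  (Q (mk4 false (T.testBit 0 || T.testBit 1) false (T.testBit 2 || T.testBit 3)) x q &&
  Q (mk4 false (T.testBit 0 || T.testBit 2) false (T.testBit 1 || T.testBit 3)) y q)))))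

/-- The values `p`, `q`, `x`, `y` at `0`, `1`, `a`, `b` agree when these points are equal. -/
def consistent (T : ℕ) (p q x y : Bool) : Bool :=
  (T.testBit 2 || (T.testBit 3 || x == p)) && ((T.testBit 0 || (T.testBit 1 || x == q)) &&
  ((T.testBit 1 || (T.testBit 3 || y == p)) && ((T.testBit 0 || (T.testBit 2 || y == q)) &&
  (T.testBit 1 || (T.testBit 2 || x == y)))))

def allBool (P : Bool → Bool) : Bool := P false && P true

theorem allBool_iff {P : Bool → Bool} : allBool P = true ↔ ∀ b, P b = true := by
  simp [allBool]

/-- Whether the local condition and the code describe the same class. -/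
def agree (P : ℕ → Bool → Bool → Bool → Bool → Bool) (c : Code) : Bool :=
  (List.range 16).all fun T => Nat.beq T 0 || allBool fun p => allBool fun q => allBool fun x =>
    allBool fun y => !(consistent T p q x y) ||
      match P T p q x y, c.mem T x y with
      | true, true => true
      | false, false => true
      | true, false => !(allPairs (fun T x y => P T p q x y) T p q x y)
      | false, true => !(allPairs c.mem T p q x y)

/-- The columns of `(a, b)` bound those of every other pair. For instance, the column `(0, 1)`
occurs in `(0, a)` only if `T` contains `(1, 0)` or `(1, 1)`. -/
theorem allPairs_of_forall {f : BoolFun} {Q : ℕ → Bool → Bool → Bool}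
    (h : ∀ T a b, Fits T a b → Q T (f.2 a) (f.2 b) = true) {T : ℕ} {a b : Fin f.1 → Bool}
    (hT : Fits T a b) : allPairs Q T (valZero f) (valOne f) (f.2 a) (f.2 b) = true := by
  have key : ∀ (t₀ t₁ t₂ t₃ : Bool) (a b : Fin f.1 → Bool),
      (∀ i, (match a i, b i with
        | false, false => t₀ | false, true => t₁ | true, false => t₂ | true, true => t₃) = true) →
      Fits (mk4 t₀ t₁ t₂ t₃) a b := by
    intro t₀ t₁ t₂ t₃ a b h
    obtain ⟨h0, h1, h2, h3, h4⟩ := testBit_mk4 t₀ t₁ t₂ t₃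
    refine ⟨h0, fun i => ?_⟩
    have := h i
    rw [testBit_ix, h1, h2, h3, h4]
    exact this
  have hT2 : ∀ i, T.testBit (ix (a i) (b i)) = true := hT.2
  simp only [allPairs, Bool.and_eq_true]
  refine ⟨h 2 _ _ ⟨by decide, fun i => (by decide : Nat.testBit 2 (ix false true) = true)⟩, h _ _ _ hT, h _ _ _ (key _ _ _ _ _ _ ?_),
    h _ _ _ (key _ _ _ _ _ _ ?_), h _ _ _ (key _ _ _ _ _ _ ?_), h _ _ _ (key _ _ _ _ _ _ ?_),
    h _ _ _ (key _ _ _ _ _ _ ?_)⟩ <;>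
  · intro i
    have := hT2 i
    revert this
    rw [testBit_ix]
    generalize T.testBit 0 = t₀
    generalize T.testBit 1 = t₁
    generalize T.testBit 2 = t₂
    generalize T.testBit 3 = t₃
    cases a i <;> cases b i <;> simp +contextual

theorem consistent_of_fits {f : BoolFun} {T : ℕ} {a b : Fin f.1 → Bool} (hT : Fits T a b) :
    consistent T (valZero f) (valOne f) (f.2 a) (f.2 b) = true := by
  have ne := fun p q h i => hT.ne (p := p) (q := q) h i
  have key : ∀ (s t : Bool) (a b : Fin f.1 → Bool), (s = false → t = false → a = b) →
      (s || (t || f.2 a == f.2 b)) = true := by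
    intro s t a b h
    cases s
    · cases t
      · rw [h rfl rfl]; simp
      · simp
    · simp
  simp only [consistent, Bool.and_eq_true]
  refine ⟨key _ _ _ _ ?_, key _ _ _ _ ?_, key _ _ _ _ ?_, key _ _ _ _ ?_, key _ _ _ _ ?_⟩ <;>
  · intro h h'
    funext i
    have := hT.2 i
    revert this
    rw [testBit_ix]
    cases a i <;> cases b i <;> simp [h, h']

theorem Fits.ne_zero {f : BoolFun} {T : ℕ} {a b : Fin f.1 → Bool} (hT : Fits T a b) : T ≠ 0 := by
  rintro rfl
  have := hT.2 ⟨0, f.1.pos⟩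
  simp at this

/-- Condition and code need not agree entry by entry: one may allow a value pair that the other
forbids. `agree` accepts this only if the permissive side is violated at another pair among `0`,
`1`, `a`, `b`, so that no member of its class has these values. Values that equal points would rule
out, and the empty `T`, are never attained and may be ignored. -/
theorem LocalClass.carrier_eq (X : LocalClass) {c : Code} (h : agree X.pred c = true) :
    X.carrier = c.toClass := by
  have key : ∀ (f : BoolFun) (T : ℕ) (a b : Fin f.1 → Bool), Fits T a b →
      (X.pred T (valZero f) (valOne f) (f.2 a) (f.2 b) = false → c.mem T (f.2 a) (f.2 b) = true →
        allPairs c.mem T (valZero f) (valOne f) (f.2 a) (f.2 b) = false) ∧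
      (X.pred T (valZero f) (valOne f) (f.2 a) (f.2 b) = true → c.mem T (f.2 a) (f.2 b) = false →
        allPairs (fun T x y => X.pred T (valZero f) (valOne f) x y) T (valZero f) (valOne f)
          (f.2 a) (f.2 b) = false) := by
    intro f T a b hT
    have h' := List.all_eq_true.1 h T (List.mem_range.2 hT.1)
    have h0 : Nat.beq T 0 = false := by
      rw [Bool.eq_false_iff]
      exact fun h => hT.ne_zero (Nat.eq_of_beq_eq_true h)
    simp only [h0, Bool.false_or, allBool_iff] at h'
    have h' := h' (valZero f) (valOne f) (f.2 a) (f.2 b)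
    rw [consistent_of_fits hT] at h'
    constructor <;>
    · intro h1 h2
      rw [h1, h2] at h'
      simpa using h'
  ext f
  rw [X.spec f]
  constructor
  · intro hX T a b hT
    by_contra hc
    have := (key f T a b hT).2 (hX T a b hT) (by simpa using hc)
    rw [allPairs_of_forall (Q := fun T x y => X.pred T (valZero f) (valOne f) x y) hX hT] at this
    exact Bool.false_ne_true this.symm
  · intro hc T a b hT
    by_contra hX
    have := (key f T a b hT).1 (by simpa using hX) (hc T a b hT)
    rw [allPairs_of_forall hc hT] at this
    exact Bool.false_ne_true this.symm

/-! ### Clones given by invariant binary relations -/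

/-- `f` preserves the binary relation `r`. -/
def Preserves (f : BoolFun) (r : Bool → Bool → Bool) : Prop :=
  ∀ a b, (∀ i, r (a i) (b i) = true) → r (f.2 a) (f.2 b) = true

def leRel (x y : Bool) : Bool := !x || y

def nandRel (x y : Bool) : Bool := !(x && y)

def orRel (x y : Bool) : Bool := x || y

def xorRel (x y : Bool) : Bool := x != y

/-- A unary invariant with a dummy second argument, so that all invariants are binary; the converse
added by `expand` constrains the other coordinate. -/
def zeroRel (x _ : Bool) : Bool := !x

def oneRel (x _ : Bool) : Bool := x

/-- The functions that preserve all relations in a list. -/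
def Inv (l : List (Bool → Bool → Bool)) : Set BoolFun := {f | ∀ r ∈ l, Preserves f r}

theorem preserves_leRel {f : BoolFun} : Preserves f leRel ↔ f ∈ M := by
  have key : ∀ x y : Bool, leRel x y = true ↔ x ≤ y := by decide
  simp only [Preserves, key]
  rfl

theorem preserves_nandRel {f : BoolFun} : Preserves f nandRel ↔ f ∈ U := by
  rw [mem_U]
  refine forall₂_congr fun a b => ?_
  rw [← not_imp_not]
  simp only [nandRel]
  generalize f.2 a = x
  generalize f.2 b = y
  cases x <;> cases y <;> simp

theorem preserves_orRel {f : BoolFun} : Preserves f orRel ↔ f ∈ W := by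
  rw [mem_W]
  refine forall₂_congr fun a b => ?_
  rw [← not_imp_not]
  simp only [orRel]
  generalize f.2 a = x
  generalize f.2 b = y
  cases x <;> cases y <;> simp

theorem preserves_xorRel {f : BoolFun} : Preserves f xorRel ↔ f ∈ S := by
  rw [mem_S]
  constructor
  · intro h a
    have := h a (fun i => !(a i)) fun i => by simp [xorRel]
    revert this
    simp only [xorRel]
    cases f.2 a <;> simp
  · intro h a b hab
    have : b = fun i => !(a i) := by
      funext i
      have := hab i
      revert this
      simp only [xorRel]
      cases a i <;> cases b i <;> simp
    rw [this, h a]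
    simp [xorRel]

theorem preserves_zeroRel {f : BoolFun} : Preserves f zeroRel ↔ valZero f = false := by
  simp only [Preserves, zeroRel, Bool.not_eq_true']
  constructor
  · exact fun h => h (fun _ => false) (fun _ => false) fun _ => rfl
  · intro h a _ ha
    rw [show a = fun _ => false from funext ha]
    exact h

theorem preserves_oneRel {f : BoolFun} : Preserves f oneRel ↔ valOne f = true := by
  simp only [Preserves, oneRel]
  constructor
  · exact fun h => h (fun _ => true) (fun _ => true) fun _ => rfl
  · intro h a _ ha
    rw [show a = fun _ => true from funext ha]
    exact h

theorem mem_Inv_nil {f : BoolFun} : f ∈ Inv [] := fun _ h => absurd h List.not_mem_nil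

theorem mem_Inv_cons {f : BoolFun} {r : Bool → Bool → Bool} {l : List (Bool → Bool → Bool)} :
    f ∈ Inv (r :: l) ↔ Preserves f r ∧ f ∈ Inv l := List.forall_mem_cons

theorem valZero_of_mem_U {f : BoolFun} (h : f ∈ U) : valZero f = false := by
  by_contra hc
  obtain ⟨i, hi, -⟩ := mem_U.1 h _ _ (Bool.eq_true_of_not_eq_false hc) (Bool.eq_true_of_not_eq_false hc)
  exact Bool.false_ne_true hi

theorem valOne_of_mem_W {f : BoolFun} (h : f ∈ W) : valOne f = true := by
  by_contra hc
  obtain ⟨i, hi, -⟩ := mem_W.1 h _ _ (Bool.eq_false_of_not_eq_true hc) (Bool.eq_false_of_not_eq_true hc)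
  exact Bool.false_ne_true hi.symm

/-- The relations that are checked for invariance, together with those that are invariant under
all functions that preserve them. -/
def expand (l : List (Bool → Bool → Bool)) : List (Bool → Bool → Bool) :=
  (fun _ _ => false) :: (fun x y => x == y) :: (l ++ l.map fun r x y => r y x)

theorem preserves_of_mem_expand {l : List (Bool → Bool → Bool)} {f : BoolFun} (hf : f ∈ Inv l)
    {r : Bool → Bool → Bool} (hr : r ∈ expand l) : Preserves f r := by
  simp only [expand, List.mem_cons, List.mem_append, List.mem_map] at hr
  rcases hr with rfl | rfl | hr | ⟨s, hs, rfl⟩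
  -- The empty relation is preserved because arities are positive.
  · exact fun a b h => absurd (h ⟨0, f.1.pos⟩) Bool.false_ne_true
  · intro a b h
    simp [show a = b from funext fun i => by simpa using h i]
  · exact hf r hr
  · exact fun a b h => hf s hs b a h

/-- `t` preserves the relations in `l`. -/
def opCheck (l : List (Bool → Bool → Bool)) (t : Bool → Bool → Bool → Bool) : Bool :=
  l.all fun r => allBool fun x => allBool fun y => allBool fun z =>
    allBool fun x' => allBool fun y' => allBool fun z' =>
      !(r x x' && (r y y' && r z z')) || r (t x y z) (t x' y' z')

theorem op3_mem_Inv {l : List (Bool → Bool → Bool)} {t : Bool → Bool → Bool → Bool}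
    (h : opCheck l t = true) : op3 t ∈ Inv l := by
  intro r hr a b hab
  have := List.all_eq_true.1 h r hr
  simp only [allBool_iff] at this
  have := this (a 0) (a 1) (a 2) (b 0) (b 1) (b 2)
  rw [show r (a 0) (b 0) = true from hab 0, show r (a 1) (b 1) = true from hab 1,
    show r (a 2) (b 2) = true from hab 2] at this
  exact this

/-- The relation with four given values. -/
def relOf (r₀ r₁ r₂ r₃ x y : Bool) : Bool := cond x (cond y r₃ r₂) (cond y r₁ r₀)

/-- Every relation that is closed under the rules is an intersection of relations in `l`. -/
def sepCheck (rules : List Rule) (l : List (Bool → Bool → Bool)) : Bool :=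
  allBool fun r₀ => allBool fun r₁ => allBool fun r₂ => allBool fun r₃ =>
    let r := relOf r₀ r₁ r₂ r₃
    !(rules.all fun R => !(r R.u.1 R.u.2 && (r R.v.1 R.v.2 && r R.w.1 R.w.2)) || r R.fst R.snd) ||
      allBool fun p => allBool fun q => r p q || l.any fun s =>
        !(s p q) && allBool fun x => allBool fun y => !(r x y) || s x y

/-- The check runs through all sixteen binary relations. This is how closure under a few operations
is traded for invariance under a whole clone. -/
theorem exists_separating {rules : List Rule} {l : List (Bool → Bool → Bool)}
    (h : sepCheck rules l = true) {r : Bool → Bool → Bool}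
    (hr : ∀ R ∈ rules, r R.u.1 R.u.2 = true → r R.v.1 R.v.2 = true → r R.w.1 R.w.2 = true →
      r R.fst R.snd = true) {p q : Bool} (hpq : ¬r p q = true) :
    ∃ s ∈ l, ¬s p q = true ∧ ∀ x y, r x y = true → s x y = true := by
  have e : relOf (r false false) (r false true) (r true false) (r true true) = r := by
    funext x y
    cases x <;> cases y <;> rfl
  simp only [sepCheck, allBool_iff] at h
  have h := h (r false false) (r false true) (r true false) (r true true)
  rw [e] at h
  have hc : (rules.all fun R => !(r R.u.1 R.u.2 && (r R.v.1 R.v.2 && r R.w.1 R.w.2)) ||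
      r R.fst R.snd) = true := by
    rw [List.all_eq_true]
    intro R hR
    have := hr R hR
    revert this
    generalize r R.u.1 R.u.2 = a
    generalize r R.v.1 R.v.2 = b
    generalize r R.w.1 R.w.2 = c
    generalize r R.fst R.snd = d
    revert a b c d
    decide
  rw [hc] at h
  simp only [Bool.not_true, Bool.false_or, allBool_iff] at h
  have h := h p q
  rw [Bool.or_eq_true] at h
  obtain ⟨s, hs, h⟩ := List.any_eq_true.1 (h.resolve_left hpq)
  simp only [Bool.and_eq_true, allBool_iff] at h
  refine ⟨s, hs, by simpa using h.1, fun x y hxy => ?_⟩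
  have := h.2 x y
  rw [hxy] at this
  exact this

theorem minorClosed_toClass (c : Code) : MinorClosed c.toClass :=
  fun _ _ _ s hf T _ _ hT => hf T _ _ ⟨hT.1, fun i => hT.2 (s i)⟩

/-- For fixed `T` the allowed value pairs form a relation closed under the rules, hence an
intersection of relations in `expand l`. Every member of the clone preserves these, so a composition
cannot produce a forbidden pair. -/
theorem isStable_toClass {l : List (Bool → Bool → Bool)} {rules : List Rule}
    (hs : sepCheck rules (expand l) = true) {c : Code} (hc : ∀ R ∈ rules, R.closed c = true) :
    IsStable Ic (Inv l) c.toClass := by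
  rw [isStable_iff]
  refine ⟨minorClosed_toClass c, ?_⟩
  rintro _ ⟨n, m, f, g, hf, hg, rfl⟩ T a b hT
  by_contra h
  obtain ⟨s, hsl, hs, hr⟩ := exists_separating hs (r := c.mem T)
    (fun R hR => (Rule.closed_iff c R).1 (hc R hR) T) h
  exact hs (preserves_of_mem_expand hf hsl _ _ fun i => hr _ _ (hg i T a b hT))

/-! ### The classification theorem -/

/-- The separate singleton case makes this unfold to the set-literal notation, so that the final
comparisons hold by `rfl`. -/
def listSet {α : Type} : List α → Set α
  | [] => ∅
  | [a] => {a}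
  | a :: b :: l => insert a (listSet (b :: l))

theorem mem_listSet {α : Type} {l : List α} {x : α} : x ∈ listSet l ↔ x ∈ l := by
  induction l with
  | nil => simp [listSet]
  | cons a l ih =>
    cases l with
    | nil => simp [listSet]
    | cons b l => rw [listSet, Set.mem_insert_iff, ih]; exact List.mem_cons.symm

/-- The classes in a table whose codes are closed under the given rules. -/
def selected (rules : List Rule) (table : List (LocalClass × Code)) : List (Set BoolFun) :=
  (table.filter fun e => rules.all (Rule.closed e.2)).map fun e => e.1.carrier

/-- The stable classes of a clone given by invariant relations `l`: the entries of a table that is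
complete for the operations in `base`, selected by closedness under `rules`. -/
theorem stableClasses_eq {l : List (Bool → Bool → Bool)} {base rules : List Rule}
    (hm : opCheck l maj = true) (hb : (base.all fun R => opCheck l R.t) = true)
    (hr : (rules.all fun R => opCheck l R.t) = true) (hs : sepCheck rules (expand l) = true)
    {table : List (LocalClass × Code)} (hz : (table.any fun e => Code.beq ⟨0, 0, 0, 0⟩ e.2) = true)
    (hj : joinCheck base (table.map Prod.snd) = true)
    (ha : (table.all fun e => agree e.1.pred e.2) = true) :
    stableClasses Ic (Inv l) = listSet (selected rules table) := by
  ext K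
  rw [mem_listSet, selected, List.mem_map]
  have hop : ∀ {rs : List Rule}, (rs.all fun R => opCheck l R.t) = true → IsStable Ic (Inv l) K →
      ∀ R ∈ rs, ClosedUnder R.t K := fun h hK R hR =>
    hK.closedUnder (op3_mem_Inv (List.all_eq_true.1 h R hR))
  constructor
  · intro hK
    have hK : IsStable Ic (Inv l) K := hK
    have hmin := hK.minorClosed
    obtain ⟨e₀, he₀, hz⟩ := List.any_eq_true.1 hz
    -- The code found is exactly the table of value pairs of `K`, so it inherits closure under every
    -- operation of the clone, not only those in `base`.
    obtain ⟨c, hc, hv⟩ := exists_code hmin (hop hb hK)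
      (List.mem_map.2 ⟨e₀, he₀, (Code.eq_of_beq hz).symm⟩) hj
    obtain ⟨e, he, rfl⟩ := List.mem_map.1 hc
    refine ⟨e, List.mem_filter.2 ⟨he, List.all_eq_true.2 fun R hR => ?_⟩, ?_⟩
    · rw [Rule.closed_iff]
      intro T h1 h2 h3
      rw [hv] at h1 h2 h3 ⊢
      exact (hop hr hK R hR).vals hmin h1 h2 h3
    · rw [e.1.carrier_eq (List.all_eq_true.1 ha e he)]
      ext f
      constructor
      -- Baker–Pixley: the code determines `K`.
      · exact fun hf => mem_of_forall_vals hmin (hK.closedUnder (op3_mem_Inv hm))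
          fun T a b hT => (hv _ _ _).1 (hf T a b hT)
      · exact fun hf T a b hT => (hv _ _ _).2 ⟨f, hf, a, b, hT, rfl, rfl⟩
  · rintro ⟨e, he, rfl⟩
    obtain ⟨he, hc⟩ := List.mem_filter.1 he
    rw [e.1.carrier_eq (List.all_eq_true.1 ha e he)]
    exact isStable_toClass hs fun R hR => List.all_eq_true.1 hc R hR

/-! ### Tables of classes -/

namespace LocalClass

theorem ends_of_pred {X : LocalClass} {K : Set BoolFun} {e : Bool → Bool → Bool}
    {h : ∀ f, f ∈ K ↔ f ∈ X.carrier ∧ e (valZero f) (valOne f) = true} {T : ℕ} {p q x y : Bool}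
    (hp : (X.ends K e h).pred T p q x y = true) : e p q = true :=
  ((Bool.and_eq_true _ _).mp hp).2

def all0xC : LocalClass := (all.atZero false).unionConst (fun p _ => p == false)
  (fun _ _ _ _ _ h => (ends_of_pred h :)) (by
    rintro (_ | _) h T
    · rfl
    · exact absurd h (by decide))

def all1xC : LocalClass := (all.atZero true).unionConst (fun p _ => p == true)
  (fun _ _ _ _ _ h => (ends_of_pred h :)) (by
    rintro (_ | _) h T
    · exact absurd h (by decide)
    · rfl)

def allx0C : LocalClass := (all.atOne false).unionConst (fun _ q => q == false)
  (fun _ _ _ _ _ h => (ends_of_pred h :)) (by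
    rintro (_ | _) h T
    · rfl
    · exact absurd h (by decide))

def allx1C : LocalClass := (all.atOne true).unionConst (fun _ q => q == true)
  (fun _ _ _ _ _ h => (ends_of_pred h :)) (by
    rintro (_ | _) h T
    · exact absurd h (by decide)
    · rfl)

def all00C : LocalClass := (all.atBoth false false).unionConst (fun p q => p == false && q == false)
  (fun _ _ _ _ _ h => (ends_of_pred h :)) (by
    rintro (_ | _) h T
    · rfl
    · exact absurd h (by decide))

def all11C : LocalClass := (all.atBoth true true).unionConst (fun p q => p == true && q == true)
  (fun _ _ _ _ _ h => (ends_of_pred h :)) (by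
    rintro (_ | _) h T
    · exact absurd h (by decide)
    · rfl)

def all01C : LocalClass := (all.atBoth false true).unionConst (fun p q => p == false && q == true)
  (fun _ _ _ _ _ h => (ends_of_pred h :)) (by rintro (_ | _) h <;> exact absurd h (by decide))

def all10C : LocalClass := (all.atBoth true false).unionConst (fun p q => p == true && q == false)
  (fun _ _ _ _ _ h => (ends_of_pred h :)) (by rintro (_ | _) h <;> exact absurd h (by decide))

def all01C0 : LocalClass := (all.atBoth false true).unionConst0 (fun p q => p == false && q == true)
  (fun _ _ _ _ _ h => (ends_of_pred h :)) (fun h => absurd h (by decide))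

def all10C1 : LocalClass := (all.atBoth true false).unionConst1 (fun p q => p == true && q == false)
  (fun _ _ _ _ _ h => (ends_of_pred h :)) (fun h => absurd h (by decide))

def all01C1 : LocalClass := (all.atBoth false true).unionConst1 (fun p q => p == false && q == true)
  (fun _ _ _ _ _ h => (ends_of_pred h :)) (fun h => absurd h (by decide))

def all10C0 : LocalClass := (all.atBoth true false).unionConst0 (fun p q => p == true && q == false)
  (fun _ _ _ _ _ h => (ends_of_pred h :)) (fun h => absurd h (by decide))

def smin01C0 : LocalClass :=
  (smin.atBoth false true).unionConst0 (fun p q => p == false && q == true)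
  (fun _ _ _ _ _ h => (ends_of_pred h :)) (fun h => absurd h (by decide))

def smin10C0 : LocalClass :=
  (smin.atBoth true false).unionConst0 (fun p q => p == true && q == false)
  (fun _ _ _ _ _ h => (ends_of_pred h :)) (fun h => absurd h (by decide))

def u01C0 : LocalClass := (u.atBoth false true).unionConst0 (fun p q => p == false && q == true)
  (fun _ _ _ _ _ h => (ends_of_pred h :)) (fun h => absurd h (by decide))

def w01negC0 : LocalClass :=
  ((w.atBoth false true).neg).unionConst0 (fun p q => (!p) == false && (!q) == true)
  (fun _ _ _ _ _ h => ((Bool.and_eq_true _ _).mp h).2) (fun h => absurd h (by decide))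

def refl00C : LocalClass :=
  (refl.atBoth false false).unionConst (fun p q => p == false && q == false)
  (fun _ _ _ _ _ h => (ends_of_pred h :)) (by
    rintro (_ | _) h T
    · simp [refl, atBoth, ends]
    · exact absurd h (by decide))

def refl11C : LocalClass := (refl.atBoth true true).unionConst (fun p q => p == true && q == true)
  (fun _ _ _ _ _ h => (ends_of_pred h :)) (by
    rintro (_ | _) h T
    · exact absurd h (by decide)
    · simp [refl, atBoth, ends])

def smaj10C1 : LocalClass :=
  (smaj.atBoth true false).unionConst1 (fun p q => p == true && q == false)
  (fun _ _ _ _ _ h => (ends_of_pred h :)) (fun h => absurd h (by decide))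

def smaj01C1 : LocalClass :=
  (smaj.atBoth false true).unionConst1 (fun p q => p == false && q == true)
  (fun _ _ _ _ _ h => (ends_of_pred h :)) (fun h => absurd h (by decide))

def u01negC1 : LocalClass :=
  ((u.atBoth false true).neg).unionConst1 (fun p q => (!p) == false && (!q) == true)
  (fun _ _ _ _ _ h => ((Bool.and_eq_true _ _).mp h).2) (fun h => absurd h (by decide))

def w01C1 : LocalClass := (w.atBoth false true).unionConst1 (fun p q => p == false && q == true)
  (fun _ _ _ _ _ h => (ends_of_pred h :)) (fun h => absurd h (by decide))

/-- The stable classes of `MU01` and their codes. -/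
def tableMU01 : List (LocalClass × Code) :=
  [(all, ⟨65534, 64764, 64764, 65534⟩), (allLe, ⟨65534, 64748, 64760, 65534⟩),
    (allGe, ⟨65534, 64760, 64748, 65534⟩), (allNeq00, ⟨65534, 64764, 64764, 65514⟩),
    (allEq, ⟨65534, 64744, 64744, 65534⟩), (all0xC, ⟨65534, 64716, 64752, 65534⟩),
    (all1xC, ⟨65534, 64752, 64716, 65534⟩), (allx0C, ⟨65534, 63736, 60652, 65534⟩),
    (allx1C, ⟨65534, 60652, 63736, 65534⟩), (all.atZero false, ⟨65534, 64716, 64752, 65472⟩),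
    (all.atZero true, ⟨65472, 64752, 64716, 65534⟩),
    (all.atOne false, ⟨65534, 63736, 60652, 60138⟩),
    (all.atOne true, ⟨60138, 60652, 63736, 65534⟩), (all00C, ⟨65534, 63688, 60640, 65534⟩),
    (all11C, ⟨65534, 60640, 63688, 65534⟩),
    (all.atBoth false false, ⟨65534, 63688, 60640, 60096⟩),
    (all.atBoth true true, ⟨60096, 60640, 63688, 65534⟩),
    (all01C, ⟨65534, 60620, 63728, 65534⟩), (all10C, ⟨65534, 63728, 60620, 65534⟩),
    (all01C0, ⟨65534, 60620, 63728, 65472⟩), (all10C1, ⟨65472, 63728, 60620, 65534⟩),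
    (all01C1, ⟨60138, 60620, 63728, 65534⟩), (all10C0, ⟨65534, 63728, 60620, 60138⟩),
    (all.atBoth false true, ⟨60138, 60620, 63728, 65472⟩),
    (all.atBoth true false, ⟨65472, 63728, 60620, 60138⟩), (smin, ⟨65534, 64764, 64764, 65450⟩),
    (smin.atZero false, ⟨65534, 64716, 64752, 65408⟩),
    (smin.atOne false, ⟨65534, 63736, 60652, 60074⟩), (smin01C0, ⟨65534, 60620, 63728, 65408⟩),
    (smin10C0, ⟨65534, 63728, 60620, 60074⟩),
    (smin.atBoth false true, ⟨60138, 60620, 63728, 65408⟩),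
    (smin.atBoth true false, ⟨65472, 63728, 60620, 60074⟩),
    (smin.atBoth false false, ⟨65534, 63688, 60640, 60032⟩),
    (mono, ⟨65534, 52428, 61680, 65534⟩), (mono.neg, ⟨65534, 61680, 52428, 65534⟩),
    (mono.atZero false, ⟨65534, 52428, 61680, 65472⟩),
    ((mono.atZero false).neg, ⟨65472, 61680, 52428, 65534⟩),
    (mono.atOne true, ⟨60138, 52428, 61680, 65534⟩),
    ((mono.atOne true).neg, ⟨65534, 61680, 52428, 60138⟩),
    (mono.atBoth false true, ⟨60138, 52428, 61680, 65472⟩),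
    ((mono.atBoth false true).neg, ⟨65472, 61680, 52428, 60138⟩),
    (u, ⟨65534, 64716, 64752, 65280⟩), (u01C0, ⟨65534, 60620, 63728, 65280⟩),
    (u.atBoth false true, ⟨60138, 60620, 63728, 65280⟩),
    (mono.inter u, ⟨65534, 52428, 61680, 65280⟩),
    ((mono.inter u).atBoth false true, ⟨60138, 52428, 61680, 65280⟩),
    (w.neg, ⟨65534, 63736, 60652, 43690⟩), (w01negC0, ⟨65534, 63728, 60620, 43690⟩),
    ((w.atBoth false true).neg, ⟨65472, 63728, 60620, 43690⟩),
    ((mono.inter w).neg, ⟨65534, 61680, 52428, 43690⟩),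
    (((mono.inter w).atBoth false true).neg, ⟨65472, 61680, 52428, 43690⟩),
    (u.atBoth false false, ⟨65534, 63688, 60640, 59904⟩),
    (w.neg.atBoth false false, ⟨65534, 63688, 60640, 43648⟩),
    (u.inter w.neg, ⟨65534, 63688, 60640, 43520⟩), (refl, ⟨65534, 64680, 64680, 65534⟩),
    (refl00C, ⟨65534, 63624, 60576, 65534⟩), (refl11C, ⟨65534, 60576, 63624, 65534⟩),
    (refl.atBoth false false, ⟨65534, 63624, 60576, 60096⟩),
    (refl.atBoth true true, ⟨60096, 60576, 63624, 65534⟩), (const, ⟨65534, 0, 0, 65534⟩),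
    (const.atBoth false false, ⟨65534, 0, 0, 0⟩), (const.atBoth true true, ⟨0, 0, 0, 65534⟩),
    (empty, ⟨0, 0, 0, 0⟩)]

/-- The stable classes of `MW01` and their codes. -/
def tableMW01 : List (LocalClass × Code) :=
  [(all, ⟨65534, 64764, 64764, 65534⟩), (allLe, ⟨65534, 64748, 64760, 65534⟩),
    (allGe, ⟨65534, 64760, 64748, 65534⟩), (allNeq11, ⟨65514, 64764, 64764, 65534⟩),
    (allEq, ⟨65534, 64744, 64744, 65534⟩), (all0xC, ⟨65534, 64716, 64752, 65534⟩),
    (all1xC, ⟨65534, 64752, 64716, 65534⟩), (allx0C, ⟨65534, 63736, 60652, 65534⟩),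
    (allx1C, ⟨65534, 60652, 63736, 65534⟩), (all.atZero false, ⟨65534, 64716, 64752, 65472⟩),
    (all.atZero true, ⟨65472, 64752, 64716, 65534⟩),
    (all.atOne false, ⟨65534, 63736, 60652, 60138⟩),
    (all.atOne true, ⟨60138, 60652, 63736, 65534⟩), (all00C, ⟨65534, 63688, 60640, 65534⟩),
    (all11C, ⟨65534, 60640, 63688, 65534⟩),
    (all.atBoth false false, ⟨65534, 63688, 60640, 60096⟩),
    (all.atBoth true true, ⟨60096, 60640, 63688, 65534⟩),
    (all01C, ⟨65534, 60620, 63728, 65534⟩), (all10C, ⟨65534, 63728, 60620, 65534⟩),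
    (all01C0, ⟨65534, 60620, 63728, 65472⟩), (all10C1, ⟨65472, 63728, 60620, 65534⟩),
    (all01C1, ⟨60138, 60620, 63728, 65534⟩), (all10C0, ⟨65534, 63728, 60620, 60138⟩),
    (all.atBoth false true, ⟨60138, 60620, 63728, 65472⟩),
    (all.atBoth true false, ⟨65472, 63728, 60620, 60138⟩), (smaj, ⟨65450, 64764, 64764, 65534⟩),
    (smaj.atZero true, ⟨65408, 64752, 64716, 65534⟩),
    (smaj.atOne true, ⟨60074, 60652, 63736, 65534⟩), (smaj10C1, ⟨65408, 63728, 60620, 65534⟩),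
    (smaj01C1, ⟨60074, 60620, 63728, 65534⟩),
    (smaj.atBoth true false, ⟨65408, 63728, 60620, 60138⟩),
    (smaj.atBoth false true, ⟨60074, 60620, 63728, 65472⟩),
    (smaj.atBoth true true, ⟨60032, 60640, 63688, 65534⟩), (mono, ⟨65534, 52428, 61680, 65534⟩),
    (mono.neg, ⟨65534, 61680, 52428, 65534⟩), (mono.atZero false, ⟨65534, 52428, 61680, 65472⟩),
    ((mono.atZero false).neg, ⟨65472, 61680, 52428, 65534⟩),
    (mono.atOne true, ⟨60138, 52428, 61680, 65534⟩),
    ((mono.atOne true).neg, ⟨65534, 61680, 52428, 60138⟩),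
    (mono.atBoth false true, ⟨60138, 52428, 61680, 65472⟩),
    ((mono.atBoth false true).neg, ⟨65472, 61680, 52428, 60138⟩),
    (u.neg, ⟨65280, 64752, 64716, 65534⟩), (u01negC1, ⟨65280, 63728, 60620, 65534⟩),
    ((u.atBoth false true).neg, ⟨65280, 63728, 60620, 60138⟩),
    ((mono.inter u).neg, ⟨65280, 61680, 52428, 65534⟩),
    (((mono.inter u).atBoth false true).neg, ⟨65280, 61680, 52428, 60138⟩),
    (w, ⟨43690, 60652, 63736, 65534⟩), (w01C1, ⟨43690, 60620, 63728, 65534⟩),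
    (w.atBoth false true, ⟨43690, 60620, 63728, 65472⟩),
    (mono.inter w, ⟨43690, 52428, 61680, 65534⟩),
    ((mono.inter w).atBoth false true, ⟨43690, 52428, 61680, 65472⟩),
    (u.neg.atBoth true true, ⟨59904, 60640, 63688, 65534⟩),
    (w.atBoth true true, ⟨43648, 60640, 63688, 65534⟩),
    (w.inter u.neg, ⟨43520, 60640, 63688, 65534⟩), (refl, ⟨65534, 64680, 64680, 65534⟩),
    (refl00C, ⟨65534, 63624, 60576, 65534⟩), (refl11C, ⟨65534, 60576, 63624, 65534⟩),
    (refl.atBoth false false, ⟨65534, 63624, 60576, 60096⟩),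
    (refl.atBoth true true, ⟨60096, 60576, 63624, 65534⟩), (const, ⟨65534, 0, 0, 65534⟩),
    (const.atBoth false false, ⟨65534, 0, 0, 0⟩), (const.atBoth true true, ⟨0, 0, 0, 65534⟩),
    (empty, ⟨0, 0, 0, 0⟩)]

/-- The stable classes of `S01` and their codes. -/
def tableS01 : List (LocalClass × Code) :=
  [(all, ⟨65534, 64764, 64764, 65534⟩), (allEq, ⟨65534, 64744, 64744, 65534⟩),
    (allNeq, ⟨65514, 64764, 64764, 65514⟩), (all.atZero false, ⟨65534, 64716, 64752, 65472⟩),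
    (all.atZero true, ⟨65472, 64752, 64716, 65534⟩),
    (all.atOne false, ⟨65534, 63736, 60652, 60138⟩),
    (all.atOne true, ⟨60138, 60652, 63736, 65534⟩),
    (all.atBoth false false, ⟨65534, 63688, 60640, 60096⟩),
    (all.atBoth true true, ⟨60096, 60640, 63688, 65534⟩),
    (all.atBoth false true, ⟨60138, 60620, 63728, 65472⟩),
    (all.atBoth true false, ⟨65472, 63728, 60620, 60138⟩),
    (selfDual, ⟨65450, 64764, 64764, 65450⟩),
    (selfDual.atBoth false true, ⟨60074, 60620, 63728, 65408⟩),
    ((selfDual.atBoth false true).neg, ⟨65408, 63728, 60620, 60074⟩),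
    (refl, ⟨65534, 64680, 64680, 65534⟩),
    (refl.atBoth false false, ⟨65534, 63624, 60576, 60096⟩),
    (refl.atBoth true true, ⟨60096, 60576, 63624, 65534⟩), (const, ⟨65534, 0, 0, 65534⟩),
    (const.atBoth false false, ⟨65534, 0, 0, 0⟩), (const.atBoth true true, ⟨0, 0, 0, 65534⟩),
    (empty, ⟨0, 0, 0, 0⟩)]

end LocalClass

open LocalClass

/-! ### Operations and rules -/

/-- Conjunction of comparable pairs returns one of them, so `(0,1)` and `(1,0)` give the only
instance that matters. The third argument is a dummy. -/
def andRules : List Rule :=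
  [⟨fun x y _ => x && y, (false, true), (true, false), (true, false)⟩]

def orRules : List Rule :=
  [⟨fun x y _ => x || y, (false, true), (true, false), (true, false)⟩]

/-- The operation lies below `z`, hence preserves `nandRel`. The rules complete `leRel` and its
converse to the full relation, so order is no longer an invariant. -/
def imp1Rules : List Rule :=
  [⟨fun x y z => z && (x || !y), (false, false), (false, true), (true, true)⟩,
    ⟨fun x y z => z && (x || !y), (false, false), (true, false), (true, true)⟩]

/-- The same effect on relations as `imp1Rules`, by an operation that lies above `x` and hence
preserves `orRel`. -/
def imp0Rules : List Rule :=
  [⟨fun x y z => x || (z && !y), (false, false), (false, true), (true, true)⟩,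
    ⟨fun x y z => x || (z && !y), (false, false), (true, false), (true, true)⟩]

/-- The sum of any three distinct pairs is the fourth, so no closed relation has exactly three
elements. -/
def xorRules : List Rule :=
  [⟨fun x y z => x ^^ (y ^^ z), (false, true), (true, false), (true, true)⟩,
    ⟨fun x y z => x ^^ (y ^^ z), (false, false), (true, false), (true, true)⟩,
    ⟨fun x y z => x ^^ (y ^^ z), (false, false), (false, true), (true, true)⟩,
    ⟨fun x y z => x ^^ (y ^^ z), (false, false), (false, true), (true, false)⟩]

/-- The rules for a unary operation. -/
def unaryRules (t : Bool → Bool) : List Rule :=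
  [(false, false), (false, true), (true, false), (true, true)].map fun p =>
    ⟨fun x _ _ => t x, p, p, p⟩

theorem empty_tableMU01 : (tableMU01.any fun e => Code.beq ⟨0, 0, 0, 0⟩ e.2) = true := by
  decide +kernel

/-- Only closure under conjunction is used, so the table is complete for each of the clones that
contain conjunction, up to `All`. -/
theorem joinCheck_tableMU01 : joinCheck andRules (tableMU01.map Prod.snd) = true := by
  decide +kernel

theorem empty_tableMW01 : (tableMW01.any fun e => Code.beq ⟨0, 0, 0, 0⟩ e.2) = true := by
  decide +kernel

theorem joinCheck_tableMW01 : joinCheck orRules (tableMW01.map Prod.snd) = true := by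
  decide +kernel

theorem empty_tableS01 : (tableS01.any fun e => Code.beq ⟨0, 0, 0, 0⟩ e.2) = true := by
  decide +kernel

theorem joinCheck_tableS01 : joinCheck xorRules (tableS01.map Prod.snd) = true := by
  decide +kernel

theorem agree_tableMU01 : (tableMU01.all fun e => agree e.1.pred e.2) = true := by
  decide +kernel

theorem agree_tableMW01 : (tableMW01.all fun e => agree e.1.pred e.2) = true := by
  decide +kernel

theorem agree_tableS01 : (tableS01.all fun e => agree e.1.pred e.2) = true := by
  decide +kernel

/-! ### The clones -/

theorem MU01_eq_Inv : MU01 = Inv [leRel, nandRel, zeroRel, oneRel] := by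
  ext f
  simp only [mem_Inv_cons, iff_true_intro mem_Inv_nil, preserves_leRel, preserves_nandRel,
    preserves_zeroRel, preserves_oneRel, MU01, MU, BoolClasses.atBoth, BoolClasses.atZero,
    BoolClasses.atOne, Set.mem_inter_iff, Set.mem_ofPred_eq]
  tauto

theorem MU_eq_Inv : MU = Inv [leRel, nandRel] := by
  ext f
  simp only [mem_Inv_cons, iff_true_intro mem_Inv_nil, preserves_leRel, preserves_nandRel,
    MU, Set.mem_inter_iff]
  tauto

theorem U01_eq_Inv : U01 = Inv [nandRel, zeroRel, oneRel] := by
  ext f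
  simp only [mem_Inv_cons, iff_true_intro mem_Inv_nil, preserves_nandRel, preserves_zeroRel,
    preserves_oneRel, U01, BoolClasses.atBoth, BoolClasses.atZero, BoolClasses.atOne,
    Set.mem_inter_iff, Set.mem_ofPred_eq]
  tauto

/-- Members of `U` vanish at `0`, so `zeroRel` is redundant for membership. It is listed because,
without `leRel`, it is not an intersection of the other invariants, and `sepCheck` needs it. -/
theorem U_eq_Inv : U = Inv [nandRel, zeroRel] := by
  ext f
  simp only [mem_Inv_cons, iff_true_intro mem_Inv_nil, preserves_nandRel, preserves_zeroRel]
  exact ⟨fun h => ⟨h, valZero_of_mem_U h, trivial⟩, fun h => h.1⟩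

theorem MW01_eq_Inv : MW01 = Inv [leRel, orRel, zeroRel, oneRel] := by
  ext f
  simp only [mem_Inv_cons, iff_true_intro mem_Inv_nil, preserves_leRel, preserves_orRel,
    preserves_zeroRel, preserves_oneRel, MW01, MW, BoolClasses.atBoth, BoolClasses.atZero,
    BoolClasses.atOne, Set.mem_inter_iff, Set.mem_ofPred_eq]
  tauto

theorem MW_eq_Inv : MW = Inv [leRel, orRel] := by
  ext f
  simp only [mem_Inv_cons, iff_true_intro mem_Inv_nil, preserves_leRel, preserves_orRel, MW,
    Set.mem_inter_iff]
  tauto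

theorem W01_eq_Inv : W01 = Inv [orRel, zeroRel, oneRel] := by
  ext f
  simp only [mem_Inv_cons, iff_true_intro mem_Inv_nil, preserves_orRel, preserves_zeroRel,
    preserves_oneRel, W01, BoolClasses.atBoth, BoolClasses.atZero, BoolClasses.atOne,
    Set.mem_inter_iff, Set.mem_ofPred_eq]
  tauto

/-- As for `U`, the redundant invariant `oneRel` is listed for the sake of `sepCheck`. -/
theorem W_eq_Inv : W = Inv [orRel, oneRel] := by
  ext f
  simp only [mem_Inv_cons, iff_true_intro mem_Inv_nil, preserves_orRel, preserves_oneRel]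
  exact ⟨fun h => ⟨h, valOne_of_mem_W h, trivial⟩, fun h => h.1⟩

theorem S01_eq_Inv : S01 = Inv [xorRel, zeroRel, oneRel] := by
  ext f
  simp only [mem_Inv_cons, iff_true_intro mem_Inv_nil, preserves_xorRel, preserves_zeroRel,
    preserves_oneRel, S01, BoolClasses.atBoth, BoolClasses.atZero, BoolClasses.atOne,
    Set.mem_inter_iff, Set.mem_ofPred_eq]
  tauto

theorem S_eq_Inv : S = Inv [xorRel] := by
  ext f
  simp only [mem_Inv_cons, iff_true_intro mem_Inv_nil, preserves_xorRel, and_true]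

theorem M01_eq_Inv : M01 = Inv [leRel, zeroRel, oneRel] := by
  ext f
  simp only [mem_Inv_cons, iff_true_intro mem_Inv_nil, preserves_leRel, preserves_zeroRel,
    preserves_oneRel, M01, BoolClasses.atBoth, BoolClasses.atZero, BoolClasses.atOne,
    Set.mem_inter_iff, Set.mem_ofPred_eq]
  tauto

theorem M0x_eq_Inv : M0x = Inv [leRel, zeroRel] := by
  ext f
  simp only [mem_Inv_cons, iff_true_intro mem_Inv_nil, preserves_leRel, preserves_zeroRel,
    M0x, BoolClasses.atZero, Set.mem_ofPred_eq]
  tauto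

theorem Mx1_eq_Inv : Mx1 = Inv [leRel, oneRel] := by
  ext f
  simp only [mem_Inv_cons, iff_true_intro mem_Inv_nil, preserves_leRel, preserves_oneRel,
    Mx1, BoolClasses.atOne, Set.mem_ofPred_eq]
  tauto

theorem M_eq_Inv : M = Inv [leRel] := by
  ext f
  simp only [mem_Inv_cons, iff_true_intro mem_Inv_nil, preserves_leRel, and_true]

theorem All01_eq_Inv : All01 = Inv [zeroRel, oneRel] := by
  ext f
  simp only [mem_Inv_cons, iff_true_intro mem_Inv_nil, preserves_zeroRel, preserves_oneRel,
    All01, All, BoolClasses.atBoth, BoolClasses.atZero, BoolClasses.atOne,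
    Set.mem_inter_iff, Set.mem_ofPred_eq, Set.mem_univ]
  tauto

theorem All0x_eq_Inv : All0x = Inv [zeroRel] := by
  ext f
  simp only [mem_Inv_cons, iff_true_intro mem_Inv_nil, preserves_zeroRel, All0x, All,
    BoolClasses.atZero, Set.mem_ofPred_eq, Set.mem_univ]
  tauto

theorem Allx1_eq_Inv : Allx1 = Inv [oneRel] := by
  ext f
  simp only [mem_Inv_cons, iff_true_intro mem_Inv_nil, preserves_oneRel, Allx1, All,
    BoolClasses.atOne, Set.mem_ofPred_eq, Set.mem_univ]
  tauto

theorem All_eq_Inv : All = Inv [] := (Set.eq_univ_of_forall fun _ => mem_Inv_nil).symm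

/-! ### The stable classes of the eighteen clones -/

theorem stableClasses_MU01 : stableClasses Ic MU01 =
    {All, AllLe, AllGe, AllNeq00, AllEq, All0xC, All1xC, Allx0C, Allx1C,
    All0x, All1x, Allx0, Allx1, All00C, All11C, All00, All11, All01C, All10C, All01C0, All10C1,
    All01C1, All10C0, All01, All10, Smin, Smin0x, Sminx0, Smin01C0, Smin10C0, Smin01, Smin10,
    Smin00, M, Mneg, M0x, M0xneg, Mx1, Mx1neg, M01, M01neg, U, U01C0, U01, MU, MU01, Wneg,
    W01negC0, W01neg, MWneg, MW01neg, U00, Wneg00, UWneg, Refl, Refl00C, Refl11C, Refl00, Refl11,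
    Const, Const0, Const1, ∅} := by
  refine (congrArg (stableClasses Ic) MU01_eq_Inv).trans ((stableClasses_eq (base := andRules)
    (rules := andRules) (by decide) (by decide) (by decide)
    (by decide +kernel) empty_tableMU01 joinCheck_tableMU01 agree_tableMU01).trans ?_)
  -- Evaluating the filter leaves the selected entries in table order, and their carriers unfold to
  -- the named classes.
  rfl

theorem stableClasses_MU : stableClasses Ic MU =
    {All, AllLe, AllGe, AllNeq00, AllEq, All0xC, All1xC, Allx0C, Allx1C,
    All0x, Allx0, All00C, All11C, All00, All01C, All10C, All01C0, All10C0, Smin, Smin0x, Sminx0,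
    Smin01C0, Smin10C0, Smin00, M, Mneg, M0x, Mx1neg, U, U01C0, MU, Wneg, W01negC0, MWneg, U00,
    Wneg00, UWneg, Refl, Refl00C, Refl11C, Refl00, Const, Const0, ∅} := by
  refine (congrArg (stableClasses Ic) MU_eq_Inv).trans ((stableClasses_eq (base := andRules)
    -- The constant 0 is in the clone. It puts `(0, 0)` into every nonempty closed relation, so
    -- `oneRel` is no longer among the relations to be separated.
    (rules := (andRules ++ (unaryRules fun _ => false))) (by decide) (by decide) (by decide)
    (by decide +kernel) empty_tableMU01 joinCheck_tableMU01 agree_tableMU01).trans ?_)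
  rfl

theorem stableClasses_U01 : stableClasses Ic U01 =
    {All, AllNeq00, AllEq, All0x, All1x, Allx0, Allx1, All00, All11, All01,
    All10, Smin, Smin0x, Sminx0, Smin01, Smin10, Smin00, U, U01, Wneg, W01neg, U00, Wneg00, UWneg,
    Refl, Refl00, Refl11, Const, Const0, Const1, ∅} := by
  refine (congrArg (stableClasses Ic) U01_eq_Inv).trans ((stableClasses_eq (base := andRules)
    (rules := (andRules ++ imp1Rules)) (by decide) (by decide) (by decide)
    (by decide +kernel) empty_tableMU01 joinCheck_tableMU01 agree_tableMU01).trans ?_)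
  rfl

theorem stableClasses_U : stableClasses Ic U =
    {All, AllNeq00, AllEq, All0x, Allx0, All00, Smin, Smin0x, Sminx0, Smin00,
    U, Wneg, U00, Wneg00, UWneg, Refl, Refl00, Const, Const0, ∅} := by
  refine (congrArg (stableClasses Ic) U_eq_Inv).trans ((stableClasses_eq (base := andRules)
    (rules := (andRules ++ imp1Rules ++ (unaryRules fun _ => false)))
    (by decide) (by decide) (by decide)
    (by decide +kernel) empty_tableMU01 joinCheck_tableMU01 agree_tableMU01).trans ?_)
  rfl

set_option maxRecDepth 100000 in
theorem stableClasses_MW01 : stableClasses Ic MW01 =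
    {All, AllLe, AllGe, AllNeq11, AllEq, All0xC, All1xC, Allx0C, Allx1C,
    All0x, All1x, Allx0, Allx1, All00C, All11C, All00, All11, All01C, All10C, All01C0, All10C1,
    All01C1, All10C0, All01, All10, Smaj, Smaj1x, Smajx1, Smaj10C1, Smaj01C1, Smaj10, Smaj01,
    Smaj11, M, Mneg, M0x, M0xneg, Mx1, Mx1neg, M01, M01neg, Uneg, U01negC1, U01neg, MUneg,
    MU01neg, W, W01C1, W01, MW, MW01, Uneg11, W11, WUneg, Refl, Refl00C, Refl11C, Refl00, Refl11,
    Const, Const0, Const1, ∅} := by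
  refine (congrArg (stableClasses Ic) MW01_eq_Inv).trans ((stableClasses_eq (base := orRules)
    (rules := orRules) (by decide) (by decide) (by decide)
    (by decide +kernel) empty_tableMW01 joinCheck_tableMW01 agree_tableMW01).trans ?_)
  rfl

theorem stableClasses_MW : stableClasses Ic MW =
    {All, AllLe, AllGe, AllNeq11, AllEq, All0xC, All1xC, Allx0C, Allx1C,
    All1x, Allx1, All00C, All11C, All11, All01C, All10C, All10C1, All01C1, Smaj, Smaj1x, Smajx1,
    Smaj10C1, Smaj01C1, Smaj11, M, Mneg, M0xneg, Mx1, Uneg, U01negC1, MUneg, W, W01C1, MW, Uneg11,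
    W11, WUneg, Refl, Refl00C, Refl11C, Refl11, Const, Const1, ∅} := by
  refine (congrArg (stableClasses Ic) MW_eq_Inv).trans ((stableClasses_eq (base := orRules)
    (rules := (orRules ++ (unaryRules fun _ => true))) (by decide) (by decide) (by decide)
    (by decide +kernel) empty_tableMW01 joinCheck_tableMW01 agree_tableMW01).trans ?_)
  rfl

theorem stableClasses_W01 : stableClasses Ic W01 =
    {All, AllNeq11, AllEq, All0x, All1x, Allx0, Allx1, All00, All11, All01,
    All10, Smaj, Smaj1x, Smajx1, Smaj10, Smaj01, Smaj11, Uneg, U01neg, W, W01, Uneg11, W11, WUneg,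
    Refl, Refl00, Refl11, Const, Const0, Const1, ∅} := by
  refine (congrArg (stableClasses Ic) W01_eq_Inv).trans ((stableClasses_eq (base := orRules)
    (rules := (orRules ++ imp0Rules)) (by decide) (by decide) (by decide)
    (by decide +kernel) empty_tableMW01 joinCheck_tableMW01 agree_tableMW01).trans ?_)
  rfl

theorem stableClasses_W : stableClasses Ic W =
    {All, AllNeq11, AllEq, All1x, Allx1, All11, Smaj, Smaj1x, Smajx1, Smaj11,
    Uneg, W, Uneg11, W11, WUneg, Refl, Refl11, Const, Const1, ∅} := by
  refine (congrArg (stableClasses Ic) W_eq_Inv).trans ((stableClasses_eq (base := orRules)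
    (rules := (orRules ++ imp0Rules ++ (unaryRules fun _ => true)))
    (by decide) (by decide) (by decide)
    (by decide +kernel) empty_tableMW01 joinCheck_tableMW01 agree_tableMW01).trans ?_)
  rfl

theorem stableClasses_S01 : stableClasses Ic S01 =
    {All, AllEq, AllNeq, All0x, All1x, Allx0, Allx1, All00, All11, All01,
    All10, S, S01, S01neg, Refl, Refl00, Refl11, Const, Const0, Const1, ∅} := by
  refine (congrArg (stableClasses Ic) S01_eq_Inv).trans ((stableClasses_eq (base := xorRules)
    (rules := xorRules) (by decide) (by decide) (by decide)
    (by decide +kernel) empty_tableS01 joinCheck_tableS01 agree_tableS01).trans ?_)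
  rfl

theorem stableClasses_S : stableClasses Ic S =
    {All, AllEq, AllNeq, S, Refl, Const, ∅} := by
  refine (congrArg (stableClasses Ic) S_eq_Inv).trans ((stableClasses_eq (base := xorRules)
    (rules := (xorRules ++ (unaryRules not))) (by decide) (by decide) (by decide)
    (by decide +kernel) empty_tableS01 joinCheck_tableS01 agree_tableS01).trans ?_)
  rfl

theorem stableClasses_M01 : stableClasses Ic M01 =
    {All, AllGe, AllLe, AllEq, All0xC, All1xC, Allx0C, Allx1C, All0x, All1x,
    Allx0, Allx1, All00C, All11C, All00, All11, All01C, All10C, All01C0, All10C1, All01C1,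
    All10C0, All01, All10, M, Mneg, M0x, M0xneg, Mx1, Mx1neg, M01, M01neg, Refl, Refl00C, Refl11C,
    Refl00, Refl11, Const, Const0, Const1, ∅} := by
  refine (congrArg (stableClasses Ic) M01_eq_Inv).trans ((stableClasses_eq (base := andRules)
    (rules := (andRules ++ orRules)) (by decide) (by decide) (by decide)
    (by decide +kernel) empty_tableMU01 joinCheck_tableMU01 agree_tableMU01).trans ?_)
  -- The table lists `AllLe` before `AllGe`, the statement the other way round.
  rw [Set.insert_comm AllGe]
  rfl

theorem stableClasses_M0x : stableClasses Ic M0x =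
    {All, AllGe, AllLe, AllEq, All0xC, All1xC, Allx0C, Allx1C, All0x, Allx0,
    All00C, All11C, All00, All01C, All10C, All01C0, All10C0, M, Mneg, M0x, Mx1neg, Refl, Refl00C,
    Refl11C, Refl00, Const, Const0, ∅} := by
  refine (congrArg (stableClasses Ic) M0x_eq_Inv).trans ((stableClasses_eq (base := andRules)
    (rules := (andRules ++ orRules ++ (unaryRules fun _ => false)))
    (by decide) (by decide) (by decide)
    (by decide +kernel) empty_tableMU01 joinCheck_tableMU01 agree_tableMU01).trans ?_)
  rw [Set.insert_comm AllGe]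
  rfl

theorem stableClasses_Mx1 : stableClasses Ic Mx1 =
    {All, AllGe, AllLe, AllEq, All0xC, All1xC, Allx0C, Allx1C, All1x, Allx1,
    All00C, All11C, All11, All01C, All10C, All10C1, All01C1, M, Mneg, M0xneg, Mx1, Refl, Refl00C,
    Refl11C, Refl11, Const, Const1, ∅} := by
  refine (congrArg (stableClasses Ic) Mx1_eq_Inv).trans ((stableClasses_eq (base := andRules)
    (rules := (andRules ++ orRules ++ (unaryRules fun _ => true)))
    (by decide) (by decide) (by decide)
    (by decide +kernel) empty_tableMU01 joinCheck_tableMU01 agree_tableMU01).trans ?_)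
  rw [Set.insert_comm AllGe]
  rfl

theorem stableClasses_M : stableClasses Ic M =
    {All, AllGe, AllLe, AllEq, All0xC, All1xC, Allx0C, Allx1C, All00C, All11C,
    All01C, All10C, M, Mneg, Refl, Refl00C, Refl11C, Const, ∅} := by
  refine (congrArg (stableClasses Ic) M_eq_Inv).trans ((stableClasses_eq (base := andRules)
    (rules := (andRules ++ orRules ++ (unaryRules fun _ => false) ++ (unaryRules fun _ => true)))
    (by decide) (by decide) (by decide)
    (by decide +kernel) empty_tableMU01 joinCheck_tableMU01 agree_tableMU01).trans ?_)
  rw [Set.insert_comm AllGe]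
  rfl

theorem stableClasses_All01 : stableClasses Ic All01 =
    {All, AllEq, All0x, All1x, Allx0, Allx1, All00, All11, All01, All10,
    Refl, Refl00, Refl11, Const, Const0, Const1, ∅} := by
  refine (congrArg (stableClasses Ic) All01_eq_Inv).trans ((stableClasses_eq (base := andRules)
    (rules := (andRules ++ orRules ++ imp1Rules)) (by decide) (by decide) (by decide)
    (by decide +kernel) empty_tableMU01 joinCheck_tableMU01 agree_tableMU01).trans ?_)
  rfl

theorem stableClasses_All0x : stableClasses Ic All0x =
    {All, AllEq, All0x, Allx0, All00, Refl, Refl00, Const, Const0, ∅} := by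
  refine (congrArg (stableClasses Ic) All0x_eq_Inv).trans ((stableClasses_eq (base := andRules)
    (rules := (andRules ++ orRules ++ imp1Rules ++ (unaryRules fun _ => false)))
    (by decide) (by decide) (by decide)
    (by decide +kernel) empty_tableMU01 joinCheck_tableMU01 agree_tableMU01).trans ?_)
  rfl

theorem stableClasses_Allx1 : stableClasses Ic Allx1 =
    {All, AllEq, All1x, Allx1, All11, Refl, Refl11, Const, Const1, ∅} := by
  refine (congrArg (stableClasses Ic) Allx1_eq_Inv).trans ((stableClasses_eq (base := andRules)
    (rules := (andRules ++ orRules ++ imp1Rules ++ (unaryRules fun _ => true)))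
    (by decide) (by decide) (by decide)
    (by decide +kernel) empty_tableMU01 joinCheck_tableMU01 agree_tableMU01).trans ?_)
  rfl

theorem stableClasses_All : stableClasses Ic All =
    {All, AllEq, Refl, Const, ∅} := by
  refine (congrArg (stableClasses Ic) All_eq_Inv).trans ((stableClasses_eq (base := andRules)
    (rules := (andRules ++ orRules ++ imp1Rules ++ (unaryRules fun _ => false) ++ (unaryRules fun _ => true)))
    (by decide) (by decide) (by decide)
    (by decide +kernel) empty_tableMU01 joinCheck_tableMU01 agree_tableMU01).trans ?_)
  rfl

end BoolClasses

theorem mainTheorem3 :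
  stableClasses Ic MU01 = {All, AllLe, AllGe, AllNeq00, AllEq, All0xC, All1xC, Allx0C, Allx1C,
    All0x, All1x, Allx0, Allx1, All00C, All11C, All00, All11, All01C, All10C, All01C0, All10C1,
    All01C1, All10C0, All01, All10, Smin, Smin0x, Sminx0, Smin01C0, Smin10C0, Smin01, Smin10,
    Smin00, M, Mneg, M0x, M0xneg, Mx1, Mx1neg, M01, M01neg, U, U01C0, U01, MU, MU01, Wneg,
    W01negC0, W01neg, MWneg, MW01neg, U00, Wneg00, UWneg, Refl, Refl00C, Refl11C, Refl00, Refl11,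
    Const, Const0, Const1, ∅} ∧
  stableClasses Ic MU = {All, AllLe, AllGe, AllNeq00, AllEq, All0xC, All1xC, Allx0C, Allx1C,
    All0x, Allx0, All00C, All11C, All00, All01C, All10C, All01C0, All10C0, Smin, Smin0x, Sminx0,
    Smin01C0, Smin10C0, Smin00, M, Mneg, M0x, Mx1neg, U, U01C0, MU, Wneg, W01negC0, MWneg, U00,
    Wneg00, UWneg, Refl, Refl00C, Refl11C, Refl00, Const, Const0, ∅} ∧
  stableClasses Ic U01 = {All, AllNeq00, AllEq, All0x, All1x, Allx0, Allx1, All00, All11, All01,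
    All10, Smin, Smin0x, Sminx0, Smin01, Smin10, Smin00, U, U01, Wneg, W01neg, U00, Wneg00, UWneg,
    Refl, Refl00, Refl11, Const, Const0, Const1, ∅} ∧
  stableClasses Ic U = {All, AllNeq00, AllEq, All0x, Allx0, All00, Smin, Smin0x, Sminx0, Smin00,
    U, Wneg, U00, Wneg00, UWneg, Refl, Refl00, Const, Const0, ∅} ∧
  stableClasses Ic MW01 = {All, AllLe, AllGe, AllNeq11, AllEq, All0xC, All1xC, Allx0C, Allx1C,
    All0x, All1x, Allx0, Allx1, All00C, All11C, All00, All11, All01C, All10C, All01C0, All10C1,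
    All01C1, All10C0, All01, All10, Smaj, Smaj1x, Smajx1, Smaj10C1, Smaj01C1, Smaj10, Smaj01,
    Smaj11, M, Mneg, M0x, M0xneg, Mx1, Mx1neg, M01, M01neg, Uneg, U01negC1, U01neg, MUneg,
    MU01neg, W, W01C1, W01, MW, MW01, Uneg11, W11, WUneg, Refl, Refl00C, Refl11C, Refl00, Refl11,
    Const, Const0, Const1, ∅} ∧
  stableClasses Ic MW = {All, AllLe, AllGe, AllNeq11, AllEq, All0xC, All1xC, Allx0C, Allx1C,
    All1x, Allx1, All00C, All11C, All11, All01C, All10C, All10C1, All01C1, Smaj, Smaj1x, Smajx1,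
    Smaj10C1, Smaj01C1, Smaj11, M, Mneg, M0xneg, Mx1, Uneg, U01negC1, MUneg, W, W01C1, MW, Uneg11,
    W11, WUneg, Refl, Refl00C, Refl11C, Refl11, Const, Const1, ∅} ∧
  stableClasses Ic W01 = {All, AllNeq11, AllEq, All0x, All1x, Allx0, Allx1, All00, All11, All01,
    All10, Smaj, Smaj1x, Smajx1, Smaj10, Smaj01, Smaj11, Uneg, U01neg, W, W01, Uneg11, W11, WUneg,
    Refl, Refl00, Refl11, Const, Const0, Const1, ∅} ∧
  stableClasses Ic W = {All, AllNeq11, AllEq, All1x, Allx1, All11, Smaj, Smaj1x, Smajx1, Smaj11,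
    Uneg, W, Uneg11, W11, WUneg, Refl, Refl11, Const, Const1, ∅} ∧
  stableClasses Ic S01 = {All, AllEq, AllNeq, All0x, All1x, Allx0, Allx1, All00, All11, All01,
    All10, S, S01, S01neg, Refl, Refl00, Refl11, Const, Const0, Const1, ∅} ∧
  stableClasses Ic S = {All, AllEq, AllNeq, S, Refl, Const, ∅} ∧
  stableClasses Ic M01 = {All, AllGe, AllLe, AllEq, All0xC, All1xC, Allx0C, Allx1C, All0x, All1x,
    Allx0, Allx1, All00C, All11C, All00, All11, All01C, All10C, All01C0, All10C1, All01C1,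
    All10C0, All01, All10, M, Mneg, M0x, M0xneg, Mx1, Mx1neg, M01, M01neg, Refl, Refl00C, Refl11C,
    Refl00, Refl11, Const, Const0, Const1, ∅} ∧
  stableClasses Ic M0x = {All, AllGe, AllLe, AllEq, All0xC, All1xC, Allx0C, Allx1C, All0x, Allx0,
    All00C, All11C, All00, All01C, All10C, All01C0, All10C0, M, Mneg, M0x, Mx1neg, Refl, Refl00C,
    Refl11C, Refl00, Const, Const0, ∅} ∧
  stableClasses Ic Mx1 = {All, AllGe, AllLe, AllEq, All0xC, All1xC, Allx0C, Allx1C, All1x, Allx1,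
    All00C, All11C, All11, All01C, All10C, All10C1, All01C1, M, Mneg, M0xneg, Mx1, Refl, Refl00C,
    Refl11C, Refl11, Const, Const1, ∅} ∧
  stableClasses Ic M = {All, AllGe, AllLe, AllEq, All0xC, All1xC, Allx0C, Allx1C, All00C, All11C,
    All01C, All10C, M, Mneg, Refl, Refl00C, Refl11C, Const, ∅} ∧
  stableClasses Ic All01 = {All, AllEq, All0x, All1x, Allx0, Allx1, All00, All11, All01, All10,
    Refl, Refl00, Refl11, Const, Const0, Const1, ∅} ∧
  stableClasses Ic All0x = {All, AllEq, All0x, Allx0, All00, Refl, Refl00, Const, Const0, ∅} ∧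
  stableClasses Ic Allx1 = {All, AllEq, All1x, Allx1, All11, Refl, Refl11, Const, Const1, ∅} ∧
  stableClasses Ic All = {All, AllEq, Refl, Const, ∅} :=
  ⟨stableClasses_MU01, stableClasses_MU, stableClasses_U01, stableClasses_U, stableClasses_MW01,
    stableClasses_MW, stableClasses_W01, stableClasses_W, stableClasses_S01, stableClasses_S,
    stableClasses_M01, stableClasses_M0x, stableClasses_Mx1, stableClasses_M,
    stableClasses_All01, stableClasses_All0x, stableClasses_Allx1, stableClasses_All⟩
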